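/- Let $k$ be an arbitrary field and let $R=\bigoplus_{m\ge 0}R_m$ be a Noetherian commutative $\mathbb N$-graded $k$-algebra with $R_0=k$. Let $\mathfrak m=\bigoplus_{m>0}R_m$ be its unique homogeneous maximal ideal and let $n=\dim R$. For each $r$ let $H^r_{\mathfrak m}(R)$ be the $r$-th local cohomology module with its natural $\mathbb Z$-grading, i.e. the $r$-th cohomology of the graded Čech complex $0\to R\to\bigoplus_i R_{y_i}\to\bigoplus_{i<j}R_{y_iy_j}\to\cdots\to R_{y_1\cdots y_s}\to 0$ of any homogeneous elements $y_1,\dots,y_s$ with $\sqrt{(y_1,\dots,y_s)}=\mathfrak m$. Suppose that $H^r_{\mathfrak m}(R)=\big[H^r_{\mathfrak m}(R)\big]_0$ for every $r<n$, that is, $H^r_{\mathfrak m}(R)$ is concentrated in degree $0$. Then for every homogeneous system of parameters $\underline x=x_1,\dots,x_n$ of $R$ (homogeneous elements, $n=\dim R$ of them, with $\sqrt{(\underline x)}=\mathfrak m$) and every $r<n$ there is an isomorphism of $k$-vector spaces $$\big[H^r(\underline x,R)\big]_0\;\cong\;H^r_{\mathfrak m}(R).$$ Here $H^r(\underline x,R)$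 is the $r$-th Koszul cohomology of $\underline x$, i.e. the $r$-th cohomology of the graded complex $\operatorname{Hom}_R(K_\bullet(\underline x),R)\colon\ 0\to R\to\bigoplus_i R(d_i)\to\cdots\to R(d_1+\cdots+d_n)\to 0$ with $d_i=\deg x_i$, and $[\,\cdot\,]_0$ denotes the degree $0$ piece. -/

import Mathlib

open Finset

/-! ### Cochain complexes indexed by the subsets of a finite ordered set

Both the Koszul cocomplex and the Cech complex of a sequence of length `s` have the shape
`C^r = ⨁_{|S| = r} M S`, with `S` running over the subsets of `Fin s`, and with the alternating
differential `(da)(T) = ∑_{i ∈ T} (-1)^{#{j ∈ T | j < i}} φ T i (a (T \ {i}))`. -/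

namespace CubeComplex

variable {A : Type*} [CommRing A] {s : ℕ} {M : Finset (Fin s) → Type*}
  [∀ S, AddCommGroup (M S)] [∀ S, Module A (M S)]

/-- The differential of the complex, on the direct sum of all its terms. -/
noncomputable def d (φ : ∀ (T : Finset (Fin s)) (i : Fin s), M (T.erase i) →ₗ[A] M T) :
    (∀ S, M S) →ₗ[A] (∀ S, M S) :=
  LinearMap.pi fun T =>
    ∑ i ∈ T, ((-1 : ℤ) ^ #{j ∈ T | j < i}) • (φ T i ∘ₗ LinearMap.proj (T.erase i))

/-- The cocycles of cohomological degree `r`: the families supported on the subsets with `r`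
elements that the differential kills. -/
def cocycles (φ : ∀ (T : Finset (Fin s)) (i : Fin s), M (T.erase i) →ₗ[A] M T) (r : ℕ) :
    Submodule A (∀ S, M S) where
  carrier := {a | (∀ S, #S ≠ r → a S = 0) ∧ d φ a = 0}
  zero_mem' := ⟨fun _ _ => rfl, map_zero _⟩
  add_mem' := fun {a b} ha hb =>
    ⟨fun S hS => by simp [ha.1 S hS, hb.1 S hS], by simp [ha.2, hb.2]⟩
  smul_mem' := fun c a ha => ⟨fun S hS => by simp [ha.1 S hS], by simp [ha.2]⟩

/-- The cochains of cohomological degree `r - 1` (only `0` if `r = 0`). -/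
def predCochains (A : Type*) [CommRing A] {s : ℕ} (M : Finset (Fin s) → Type*)
    [∀ S, AddCommGroup (M S)] [∀ S, Module A (M S)] (r : ℕ) : Submodule A (∀ S, M S) where
  carrier := {a | ∀ S, #S + 1 ≠ r → a S = 0}
  zero_mem' := fun _ _ => rfl
  add_mem' := fun {a b} ha hb S hS => by simp [ha S hS, hb S hS]
  smul_mem' := fun c a ha S hS => by simp [ha S hS]

/-- The coboundaries of cohomological degree `r`, as a submodule of the cocycles. -/
noncomputable def coboundaries
    (φ : ∀ (T : Finset (Fin s)) (i : Fin s), M (T.erase i) →ₗ[A] M T) (r : ℕ) :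
    Submodule A (cocycles φ r) :=
  ((predCochains A M r).map (d φ)).comap (cocycles φ r).subtype

/-- The `r`-th cohomology module. -/
abbrev Cohomology (φ : ∀ (T : Finset (Fin s)) (i : Fin s), M (T.erase i) →ₗ[A] M T) (r : ℕ) :
    Type _ :=
  cocycles φ r ⧸ coboundaries φ r

/-- The degree `m` piece of the `r`-th cohomology module, where `gr S m` is the degree `m` piece
of `M S`: the classes of the homogeneous cocycles of internal degree `m`. -/
noncomputable def cohomologyPiece {k : Type*} [Field k] [Algebra k A] [∀ S, Module k (M S)]
    [∀ S, IsScalarTower k A (M S)]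
    (φ : ∀ (T : Finset (Fin s)) (i : Fin s), M (T.erase i) →ₗ[A] M T)
    (gr : ∀ S, ℤ → Submodule k (M S)) (r : ℕ) (m : ℤ) : Submodule k (Cohomology φ r) :=
  ((Submodule.pi Set.univ fun S => gr S m).comap
    ((cocycles φ r).subtype.restrictScalars k)).map
      ((coboundaries φ r).mkQ.restrictScalars k)

end CubeComplex

section Graded

variable {k R : Type*} [Field k] [CommRing R] [Algebra k R]

/-- The degree `m` piece `R_m` of an `ℕ`-graded ring for `m : ℤ`; it is `0` for negative `m`. -/
def intPiece (𝒜 : ℕ → Submodule k R) : ℤ → Submodule k R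
  | Int.ofNat m => 𝒜 m
  | Int.negSucc _ => ⊥

/-! ### Koszul cohomology -/

/-- The maps of the Koszul cocomplex `Hom_R(K_•(x), R)`: multiplication by `x i`. -/
noncomputable def koszulMap {n : ℕ} (x : Fin n → R) (_T : Finset (Fin n)) (i : Fin n) :
    R →ₗ[R] R :=
  LinearMap.mulLeft R (x i)

/-- The Koszul cohomology module `H^r(x, R)`. -/
abbrev KoszulCohomology {n : ℕ} (x : Fin n → R) (r : ℕ) : Type _ :=
  CubeComplex.Cohomology (M := fun _ => R) (koszulMap x) r

/-- The degree `m` piece `[H^r(x, R)]_m`, where `x i` is homogeneous of degree `δ i`: the summand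
of the Koszul cocomplex with index `S` is the twist `R(∑_{i ∈ S} δ i)`. -/
noncomputable def koszulPiece (𝒜 : ℕ → Submodule k R) {n : ℕ} (x : Fin n → R) (δ : Fin n → ℕ)
    (r : ℕ) (m : ℤ) : Submodule k (KoszulCohomology x r) :=
  CubeComplex.cohomologyPiece (M := fun _ => R) (koszulMap x)
    (fun S m => intPiece 𝒜 (m + ∑ i ∈ S, (δ i : ℤ))) r m

/-! ### Local cohomology -/

/-- The maps of the Cech complex: the localization maps
`R[1 / ∏_{j ∈ T \ {i}} y j] → R[1 / ∏_{j ∈ T} y j]`. -/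
noncomputable def cechMap {s : ℕ} (y : Fin s → R) (T : Finset (Fin s)) (i : Fin s) :
    Localization.Away (∏ j ∈ T.erase i, y j) →ₗ[R] Localization.Away (∏ j ∈ T, y j) :=
  (IsLocalization.liftAlgHom (M := Submonoid.powers (∏ j ∈ T.erase i, y j))
    (f := Algebra.ofId R (Localization.Away (∏ j ∈ T, y j))) (by
      rintro ⟨_, N, rfl⟩
      have h : IsUnit (algebraMap R (Localization.Away (∏ j ∈ T, y j)) (∏ j ∈ T.erase i, y j)) :=
        isUnit_of_dvd_unit
          (map_dvd _ (Finset.prod_dvd_prod_of_subset _ _ _ (Finset.erase_subset i T)))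
          (IsLocalization.Away.algebraMap_isUnit (∏ j ∈ T, y j))
      simpa [Algebra.ofId_apply] using h.pow N)).toLinearMap

/-- The local cohomology module `H^r_I(R)`, with `I` the radical of the ideal `(y 1, …, y s)`, as
the cohomology of the Cech complex `0 → R → ⨁ R[1/y i] → ⨁ R[1/(y i * y j)] → ⋯`. -/
abbrev CechLocalCohomology {s : ℕ} (y : Fin s → R) (r : ℕ) : Type _ :=
  CubeComplex.Cohomology (M := fun S => Localization.Away (∏ j ∈ S, y j)) (cechMap y) r

/-- The degree `m` piece of `R[1/f]`, for `f` homogeneous of degree `e`: it is spanned by the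
fractions `a / f ^ N` with `a` homogeneous of degree `m + N * e`. -/
noncomputable def awayPiece (𝒜 : ℕ → Submodule k R) (f : R) (e : ℕ) (m : ℤ) :
    Submodule k (Localization.Away f) :=
  Submodule.span k {z | ∃ (N : ℕ) (a : R), a ∈ intPiece 𝒜 (m + N * e) ∧
    z = Localization.mk a (⟨f ^ N, ⟨N, rfl⟩⟩ : Submonoid.powers f)}

/-- The degree `m` piece `[H^r_I(R)]_m` of local cohomology, where `y i` is homogeneous of degree
`ε i`. -/
noncomputable def cechPiece (𝒜 : ℕ → Submodule k R) {s : ℕ} (y : Fin s → R) (ε : Fin s → ℕ)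
    (r : ℕ) (m : ℤ) : Submodule k (CechLocalCohomology y r) :=
  CubeComplex.cohomologyPiece (M := fun S => Localization.Away (∏ j ∈ S, y j)) (cechMap y)
    (fun S m => awayPiece 𝒜 (∏ j ∈ S, y j) (∑ j ∈ S, ε j) m) r m

/-- The elements `y i` are homogeneous of degrees `ε i` and generate the homogeneous maximal ideal
`𝔪 = ⨁_{m > 0} R_m` up to radical. -/
structure GeneratesIrrelevantUpToRadical (𝒜 : ℕ → Submodule k R) [GradedAlgebra 𝒜] {s : ℕ}
    (y : Fin s → R) (ε : Fin s → ℕ) : Prop where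
  homogeneous : ∀ i, y i ∈ 𝒜 (ε i)
  radical_eq : (Ideal.span (Set.range y)).radical = (HomogeneousIdeal.irrelevant 𝒜).toIdeal

/-- A homogeneous system of parameters: `dim R` homogeneous elements `x i`, of degrees `δ i`, which
generate the homogeneous maximal ideal up to radical. -/
structure IsHomogeneousSystemOfParameters (𝒜 : ℕ → Submodule k R) [GradedAlgebra 𝒜] {n : ℕ}
    (x : Fin n → R) (δ : Fin n → ℕ) : Prop extends GeneratesIrrelevantUpToRadical 𝒜 x δ where
  dim_eq : ringKrullDim R = n

end Graded

/-! ### Comparison of the two edges of a first quadrant double complex -/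

/-! The proof compares Koszul and Čech cohomology through the internal degree `0` strand of the
double complex `K^p(x, R) ⊗ C^q(y)`. Its term at `(p, q)` is the sum, over `S` with `p` elements and
`T` with `q` elements, of the piece of `R[1 / ∏_{j ∈ T} y j]` of degree `∑ i ∈ S, δ i`.

For `p > 0`, the row through a fixed `S` is the Čech complex in degree `∑ i ∈ S, δ i > 0`. It is
exact below `n` because local cohomology sits in degree `0` there (`exists_d_cechMap_eq`). For `q >
0`, a column is a Koszul complex over a ring in which some `y j` is invertible. Since `y j` lies in
the radical of `(x)`, the `x i` generate the unit ideal there, and a contracting homotopy makes the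
column exact (`exists_diff_eq`).

Hence, for `r < n`, total cohomology is identified with the cohomology of each surviving edge: the
row `p = 0` is the degree `0` Čech complex, the column `q = 0` the degree `0` Koszul complex. No
total cohomology module is formed. Both edge maps are defined on the total cocycles; zigzags
(`Bicomplex.exists_mem_totalCocycles`, `Bicomplex.isTotalCoboundary_of_row_zero`) show that their
images are the two degree `0` pieces and that both kernels consist of the total coboundaries.

Two points need separate work. The localizations need honest projections onto their graded pieces,
supplied by a coaction into Laurent polynomials. The degrees `δ i` must be positive: a parameter of
degree `0` would vanish, and fewer than `dim R` elements would then generate `𝔪` up to radical,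
contradicting `ringKrullDim_le_card`. -/

/-- Exactness of the complex `B 0 → B 1 → ⋯` at the `q`-th term. -/
def ExactAtTerm {k M : Type*} [CommRing k] [AddCommGroup M] [Module k M]
    (B : ℕ → Submodule k M) (d : M →ₗ[k] M) : ℕ → Prop
  | 0 => ∀ b ∈ B 0, d b = 0 → b = 0
  | q + 1 => ∀ b ∈ B (q + 1), d b = 0 → ∃ c ∈ B q, d c = b

/-- At `q = 0` the preimage is required to be `0`, which forces `a = 0`. This form lets one
construction, with support conditions such as `#S + 1 ≠ q`, serve both cases. -/
theorem exactAtTerm_of_exists {k M : Type*} [CommRing k] [AddCommGroup M] [Module k M]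
    {B : ℕ → Submodule k M} {d : M →ₗ[k] M} {q : ℕ}
    (h : ∀ a ∈ B q, d a = 0 → ∃ b, (q = 0 → b = 0) ∧ (∀ q', q = q' + 1 → b ∈ B q') ∧ d b = a) :
    ExactAtTerm B d q := by
  cases q with
  | zero =>
    intro a ha hda
    obtain ⟨b, b1, -, rfl⟩ := h a ha hda
    rw [b1 rfl, map_zero]
  | succ q =>
    intro a ha hda
    obtain ⟨b, -, b2, b3⟩ := h a ha hda
    exact ⟨b, b2 q rfl, b3⟩

/-! ### Zigzag arguments in a double complex inside one ambient module -/

namespace Bicomplex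

variable {k M : Type*} [CommRing k] [AddCommGroup M] [Module k M]

/-- The cocycles of degree `r` of the total complex. -/
def totalCocycles (B : ℕ → ℕ → Submodule k M) (d₁ d₂ : M →ₗ[k] M) (r : ℕ) :
    Submodule k (ℕ → ℕ → M) where
  carrier := {z | (∀ p q, z p q ∈ B p q) ∧ (∀ p q, p + q ≠ r → z p q = 0) ∧
    (∀ p, d₁ (z p 0) = 0) ∧ (∀ q, d₂ (z 0 q) = 0) ∧
    ∀ p q, d₁ (z p (q + 1)) + d₂ (z (p + 1) q) = 0}
  zero_mem' := by simp
  add_mem' := by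
    rintro a b ⟨a1, a2, a3, a4, a5⟩ ⟨b1, b2, b3, b4, b5⟩
    refine ⟨fun p q => add_mem (a1 p q) (b1 p q), fun p q h => by simp [a2 p q h, b2 p q h],
      fun p => by simp [a3 p, b3 p], fun q => by simp [a4 q, b4 q], fun p q => ?_⟩
    have := congrArg₂ (· + ·) (a5 p q) (b5 p q)
    simp only [Pi.add_apply, map_add] at this ⊢
    rw [← add_zero (0 : M), ← this]; abel
  smul_mem' := by
    rintro c a ⟨a1, a2, a3, a4, a5⟩
    refine ⟨fun p q => (B p q).smul_mem c (a1 p q), fun p q h => by simp [a2 p q h],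
      fun p => by simp [a3 p], fun q => by simp [a4 q], fun p q => ?_⟩
    simp only [Pi.smul_apply, map_smul, ← smul_add, a5 p q, smul_zero]

/-- The coboundaries of degree `r` of the total complex. -/
def IsTotalCoboundary (B : ℕ → ℕ → Submodule k M) (d₁ d₂ : M →ₗ[k] M) (r : ℕ)
    (z : ℕ → ℕ → M) : Prop :=
  ∃ c : ℕ → ℕ → M, (∀ p q, c p q ∈ B p q) ∧ (∀ p q, p + q + 1 ≠ r → c p q = 0) ∧
    z 0 0 = 0 ∧ (∀ p, z (p + 1) 0 = d₁ (c p 0)) ∧ (∀ q, z 0 (q + 1) = d₂ (c 0 q)) ∧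
    ∀ p q, z (p + 1) (q + 1) = d₁ (c p (q + 1)) + d₂ (c (p + 1) q)

theorem mem_totalCocycles_swap {B : ℕ → ℕ → Submodule k M} {d₁ d₂ : M →ₗ[k] M} {r : ℕ}
    {z : ℕ → ℕ → M} (hz : z ∈ totalCocycles B d₁ d₂ r) :
    (fun p q => z q p) ∈ totalCocycles (fun p q => B q p) d₂ d₁ r := by
  obtain ⟨h1, h2, h3, h4, h5⟩ := hz
  exact ⟨fun p q => h1 q p, fun p q h => h2 q p (by rwa [add_comm]), h4, h3,
    fun p q => by rw [add_comm]; exact h5 q p⟩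

theorem IsTotalCoboundary.swap {B : ℕ → ℕ → Submodule k M} {d₁ d₂ : M →ₗ[k] M} {r : ℕ}
    {z : ℕ → ℕ → M} (hz : IsTotalCoboundary B d₁ d₂ r z) :
    IsTotalCoboundary (fun p q => B q p) d₂ d₁ r (fun p q => z q p) := by
  obtain ⟨c, h1, h2, h3, h4, h5, h6⟩ := hz
  exact ⟨fun p q => c q p, fun p q => h1 q p, fun p q h => h2 q p (by rwa [add_comm q p]), h3, h5,
    h4, fun p q => (h6 q p).trans (add_comm _ _)⟩

variable {B : ℕ → ℕ → Submodule k M} {d₁ d₂ : M →ₗ[k] M} {n r : ℕ}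
  (h₁ : ∀ a, d₁ (d₁ a) = 0) (hanti : ∀ a, d₂ (d₁ a) = -d₁ (d₂ a))
  (hB₁ : ∀ p q, ∀ b ∈ B p q, d₁ b ∈ B (p + 1) q)
  (hex : ∀ p q, q < n → ExactAtTerm (B (p + 1)) d₂ q)

include h₁ hanti hB₁ hex

/-- If the rows other than the `0`-th one are exact in degrees below `n`, then the cocycles of the
`0`-th row of degree `r < n` extend to cocycles of the total complex. -/
theorem exists_mem_totalCocycles (hr : r < n) {e : M} (he : e ∈ B 0 r) (hde : d₂ e = 0) :
    ∃ z ∈ totalCocycles B d₁ d₂ r, z 0 r = e := by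
  -- One step of the staircase, from row `p` to row `p + 1`. Outside the meaningful range the value
  -- is `0`, so that `choose` gives a total function that can be iterated.
  have step : ∀ (p : ℕ) (a : M), ∃ b : M, p < r → a ∈ B p (r - p) → d₂ (d₁ a) = 0 →
      b ∈ B (p + 1) (r - (p + 1)) ∧ d₂ b = -d₁ a := by
    intro p a
    by_cases h : p < r ∧ a ∈ B p (r - p) ∧ d₂ (d₁ a) = 0
    · obtain ⟨hp, ha, hda⟩ := h
      obtain ⟨q, hq⟩ : ∃ q, r - p = q + 1 := ⟨r - p - 1, by omega⟩
      have hq' : r - (p + 1) = q := by omega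
      have := hex p (q + 1) (by omega)
      obtain ⟨b, hb, hb'⟩ := this (-d₁ a) (neg_mem (hB₁ _ _ _ (hq ▸ ha))) (by simp [hda])
      exact ⟨b, fun _ _ _ => ⟨hq' ▸ hb, hb'⟩⟩
    · exact ⟨0, fun h1 h2 h3 => absurd ⟨h1, h2, h3⟩ h⟩
  choose f hf using step
  let u : ℕ → M := fun t => Nat.rec e f t
  have hu : ∀ p, p ≤ r → u p ∈ B p (r - p) ∧ d₂ (d₁ (u p)) = 0 := by
    intro p
    induction p with
    | zero => exact fun _ => ⟨he, by rw [hanti]; change -d₁ (d₂ e) = 0; simp [hde]⟩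
    | succ p ih =>
      intro hp
      obtain ⟨i1, i2⟩ := ih (by omega)
      obtain ⟨j1, j2⟩ := hf p (u p) (by omega) i1 i2
      refine ⟨j1, ?_⟩
      rw [hanti]
      change -d₁ (d₂ (f p (u p))) = 0
      rw [j2, map_neg, h₁]; simp
  have hus : ∀ p, p < r → d₂ (u (p + 1)) = -d₁ (u p) := fun p hp =>
    (hf p (u p) hp (hu p hp.le).1 (hu p hp.le).2).2
  -- The staircase ends at the term `(r + 1, 0)`, where exactness says that `d₂` is injective.
  have hlast : d₁ (u r) = 0 := by
    refine hex r 0 (by omega) _ (hB₁ _ _ _ ?_) (hu r le_rfl).2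
    simpa using (hu r le_rfl).1
  refine ⟨fun p q => if p + q = r then u p else 0, ⟨fun p q => ?_, fun p q h => if_neg h,
    fun p => ?_, fun q => ?_, fun p q => ?_⟩, by simp [u]⟩
  · dsimp only
    split_ifs with h
    · have := (hu p (by omega)).1
      rwa [show r - p = q by omega] at this
    · exact zero_mem _
  · dsimp only
    split_ifs with h
    · rw [show p = r by omega]; exact hlast
    · simp
  · dsimp only
    split_ifs with h
    · exact hde
    · simp
  · dsimp only
    by_cases h : p + (q + 1) = r
    · rw [if_pos h, if_pos (by omega), hus p (by omega)]; simp
    · rw [if_neg h, if_neg (by omega)]; simp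

/-- If the rows other than the `0`-th one are exact in degrees below `n`, then a total cocycle of
degree `r < n` whose component in the `0`-th row is a coboundary is a total coboundary. -/
theorem isTotalCoboundary_of_row_zero (hr : r < n) {z : ℕ → ℕ → M}
    (hz : z ∈ totalCocycles B d₁ d₂ r) (hz0 : z 0 0 = 0)
    (hzr : ∀ q, r = q + 1 → ∃ c ∈ B 0 q, z 0 r = d₂ c) : IsTotalCoboundary B d₁ d₂ r z := by
  obtain ⟨z1, z2, z3, z4, z5⟩ := hz
  -- In degree `0` the only possible component is `z 0 0`, which vanishes. Otherwise `z` has degree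
  -- `r + 1` from here on and the bounding cochain has degree `r`.
  obtain _ | r := r
  · refine ⟨0, fun p q => zero_mem _, fun _ _ _ => rfl, hz0, fun p => ?_, fun q => ?_,
      fun p q => ?_⟩ <;> simp <;> exact z2 _ _ (by omega)
  obtain ⟨e, he, hze⟩ := hzr r rfl
  have step : ∀ (p : ℕ) (a : M), ∃ b : M, p < r → a ∈ B p (r - p) →
      d₂ (z (p + 1) (r - p) - d₁ a) = 0 →
      b ∈ B (p + 1) (r - (p + 1)) ∧ d₂ b = z (p + 1) (r - p) - d₁ a := by
    intro p a
    by_cases h : p < r ∧ a ∈ B p (r - p) ∧ d₂ (z (p + 1) (r - p) - d₁ a) = 0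
    · obtain ⟨hp, ha, hda⟩ := h
      obtain ⟨q, hq⟩ : ∃ q, r - p = q + 1 := ⟨r - p - 1, by omega⟩
      have hq' : r - (p + 1) = q := by omega
      have := hex p (q + 1) (by omega)
      obtain ⟨b, hb, hb'⟩ := this _ (sub_mem (z1 _ _) (hB₁ _ _ _ (hq ▸ ha))) (hq ▸ hda)
      exact ⟨b, fun _ _ _ => ⟨hq' ▸ hb, hq ▸ hb'⟩⟩
    · exact ⟨0, fun h1 h2 h3 => absurd ⟨h1, h2, h3⟩ h⟩
  choose f hf using step
  let u : ℕ → M := fun t => Nat.rec e f t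
  -- With `u p` chosen, what remains of `z` in the next row is `z - d₁ (u p)`. It is a `d₂`-cocycle
  -- by the cocycle condition on `z` and anticommutation, so the next entry can be chosen to bound
  -- it.
  have hu : ∀ p, p ≤ r → u p ∈ B p (r - p) ∧ d₂ (z (p + 1) (r - p) - d₁ (u p)) = 0 := by
    intro p
    induction p with
    | zero =>
      refine fun _ => ⟨he, ?_⟩
      have := z5 0 r
      rw [hze] at this
      rw [map_sub, hanti]
      change d₂ (z 1 r) - -d₁ (d₂ e) = 0
      rw [sub_neg_eq_add, add_comm]
      exact this
    | succ p ih =>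
      intro hp
      obtain ⟨i1, i2⟩ := ih (by omega)
      obtain ⟨j1, j2⟩ := hf p (u p) (by omega) i1 i2
      refine ⟨j1, ?_⟩
      rw [map_sub, hanti]
      change _ - -d₁ (d₂ (f p (u p))) = 0
      rw [j2, map_sub, h₁, sub_zero, sub_neg_eq_add, add_comm]
      have := z5 (p + 1) (r - (p + 1))
      rwa [show r - (p + 1) + 1 = r - p by omega] at this
  have hus : ∀ p, p < r → d₂ (u (p + 1)) = z (p + 1) (r - p) - d₁ (u p) := fun p hp =>
    (hf p (u p) hp (hu p hp.le).1 (hu p hp.le).2).2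
  have hlast : z (r + 1) 0 = d₁ (u r) := by
    refine sub_eq_zero.1 (hex r 0 (by omega) _ (sub_mem (z1 _ _) (hB₁ _ _ _ ?_)) ?_)
    · simpa using (hu r le_rfl).1
    · simpa using (hu r le_rfl).2
  refine ⟨fun p q => if p + q = r then u p else 0, fun p q => ?_,
    fun p q h => if_neg (by omega), hz0, fun p => ?_, fun q => ?_, fun p q => ?_⟩
  · dsimp only
    split_ifs with h
    · have := (hu p (by omega)).1
      rwa [show r - p = q by omega] at this
    · exact zero_mem _
  · dsimp only
    split_ifs with h
    · rw [show p = r by omega]; exact hlast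
    · rw [map_zero]; exact z2 _ _ (by omega)
  · dsimp only
    split_ifs with h
    · rw [show q = r by omega]; exact hze
    · rw [map_zero]; exact z2 _ _ (by omega)
  · dsimp only
    by_cases h : p + (q + 1) = r
    · rw [if_pos h, if_pos (by omega), hus p (by omega), show r - p = q + 1 by omega]; abel
    · rw [if_neg h, if_neg (by omega), z2 _ _ (by omega)]; simp

end Bicomplex

/-- Two quotients of a module by the same submodule are isomorphic. -/
noncomputable def LinearMap.rangeEquivOfKerEq {k Z M N : Type*} [CommRing k] [AddCommGroup Z]
    [AddCommGroup M] [AddCommGroup N] [Module k Z] [Module k M] [Module k N] (f : Z →ₗ[k] M)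
    (g : Z →ₗ[k] N) (h : LinearMap.ker f = LinearMap.ker g) :
    LinearMap.range f ≃ₗ[k] LinearMap.range g :=
  f.quotKerEquivRange.symm ≪≫ₗ Submodule.quotEquivOfEq _ _ h ≪≫ₗ g.quotKerEquivRange

/-! ### Signs and functoriality of the cube differential -/

namespace CubeComplex

/-- The sign of `i` in the subset `T`. -/
def sgn {s : ℕ} (T : Finset (Fin s)) (i : Fin s) : ℤ := (-1) ^ #{j ∈ T | j < i}

theorem sgn_mul_self {s : ℕ} (T : Finset (Fin s)) (i : Fin s) : sgn T i * sgn T i = 1 := by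
  rw [sgn, ← pow_add, Even.neg_one_pow ⟨_, rfl⟩]

theorem sgn_erase_of_lt {s : ℕ} {T : Finset (Fin s)} {i j : Fin s} (hi : i ∈ T) (h : i < j) :
    sgn (T.erase i) j = -sgn T j := by
  have hm : i ∈ {l ∈ T | l < j} := by simp [hi, h]
  rw [sgn, sgn, filter_erase, ← card_erase_add_one hm, pow_succ]; simp

theorem sgn_erase_of_le {s : ℕ} {T : Finset (Fin s)} {i j : Fin s} (h : j ≤ i) :
    sgn (T.erase i) j = sgn T j := by
  rw [sgn, sgn, filter_erase, erase_eq_of_notMem]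
  simp [h]

variable {A : Type*} [CommRing A] {s : ℕ} {M : Finset (Fin s) → Type*}
  [∀ S, AddCommGroup (M S)] [∀ S, Module A (M S)]

theorem d_apply (φ : ∀ (T : Finset (Fin s)) (i : Fin s), M (T.erase i) →ₗ[A] M T)
    (a : ∀ S, M S) (T : Finset (Fin s)) :
    d φ a T = ∑ i ∈ T, sgn T i • φ T i (a (T.erase i)) := by
  simp [d, sgn]

theorem d_apply_eq_zero (φ : ∀ (T : Finset (Fin s)) (i : Fin s), M (T.erase i) →ₗ[A] M T)
    {a : ∀ S, M S} {T : Finset (Fin s)} (h : ∀ i ∈ T, a (T.erase i) = 0) : d φ a T = 0 := by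
  rw [d_apply]
  exact Finset.sum_eq_zero fun i hi => by rw [h i hi, map_zero, smul_zero]

/-- The maps are only `k`-linear and may vary with `S`, because the main application is to
projections onto graded pieces whose degree depends on `S`. Compatibility is asked only for `i ∈ T`,
where removing `i` lowers that degree as it should. -/
theorem map_d {k : Type*} [CommRing k] [∀ S, Module k (M S)] {M' : Finset (Fin s) → Type*}
    [∀ S, AddCommGroup (M' S)] [∀ S, Module A (M' S)] [∀ S, Module k (M' S)]
    (φ : ∀ (T : Finset (Fin s)) (i : Fin s), M (T.erase i) →ₗ[A] M T)
    (φ' : ∀ (T : Finset (Fin s)) (i : Fin s), M' (T.erase i) →ₗ[A] M' T)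
    (g : ∀ S, M S →ₗ[k] M' S) {T : Finset (Fin s)}
    (hg : ∀ i ∈ T, ∀ z, g T (φ T i z) = φ' T i (g (T.erase i) z)) (a : ∀ S, M S) :
    g T (d φ a T) = d φ' (fun S => g S (a S)) T := by
  rw [d_apply, d_apply, map_sum]
  exact Finset.sum_congr rfl fun i hi => by rw [map_zsmul, hg i hi]

/-- The ordered pairs `(i, j)` and `(j, i)` remove the same two elements with opposite signs, so
their terms cancel. The hypothesis evaluates a whole family `a`, since the two iterated erasures are
equal sets but index modules that are not definitionally equal. -/
theorem d_d (φ : ∀ (T : Finset (Fin s)) (i : Fin s), M (T.erase i) →ₗ[A] M T)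
    (hφ : ∀ (a : ∀ S, M S) (T : Finset (Fin s)) (i j : Fin s),
      φ T i (φ (T.erase i) j (a ((T.erase i).erase j))) =
        φ T j (φ (T.erase j) i (a ((T.erase j).erase i))))
    (a : ∀ S, M S) : d φ (d φ a) = 0 := by
  funext T
  rw [d_apply, Pi.zero_apply]
  simp only [d_apply, map_sum, map_zsmul, smul_sum, smul_smul]
  rw [Finset.sum_sigma']
  refine Finset.sum_involution (fun p _ => ⟨p.2, p.1⟩) ?_ ?_ ?_ ?_
  · rintro ⟨i, j⟩ h
    simp only [mem_sigma, mem_erase] at h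
    dsimp only
    rw [hφ a T i j, ← add_smul]
    rcases lt_or_gt_of_ne h.2.1 with hij | hij
    · rw [sgn_erase_of_le hij.le, sgn_erase_of_lt h.2.2 hij]
      convert zero_smul ℤ _ using 2
      ring
    · rw [sgn_erase_of_le (T := T) hij.le, sgn_erase_of_lt h.1 hij]
      convert zero_smul ℤ _ using 2
      ring
  · rintro ⟨i, j⟩ h - e
    simp only [mem_sigma, mem_erase] at h
    exact h.2.1 (congrArg Sigma.fst e)
  · rintro ⟨i, j⟩ h
    simp only [mem_sigma, mem_erase] at h ⊢
    exact ⟨h.2.2, Ne.symm h.2.1, h.1⟩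
  · rintro ⟨i, j⟩ h
    rfl

end CubeComplex

/-! ### Koszul cochains with coefficients in a module -/

namespace Koszul

open CubeComplex

variable {R N : Type*} [CommRing R] [AddCommGroup N] [Module R N] {n : ℕ}

/-- The Koszul differential on the cochains with values in `N`. -/
noncomputable def diff (x : Fin n → R) :
    (Finset (Fin n) → N) →ₗ[R] (Finset (Fin n) → N) :=
  CubeComplex.d (M := fun _ => N) fun _ i => LinearMap.lsmul R N (x i)

theorem diff_apply (x : Fin n → R) (a : Finset (Fin n) → N) (S : Finset (Fin n)) :
    diff x a S = ∑ i ∈ S, sgn S i • x i • a (S.erase i) :=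
  CubeComplex.d_apply _ _ _

theorem diff_apply_eq_zero (x : Fin n → R) {a : Finset (Fin n) → N} {S : Finset (Fin n)}
    (h : ∀ i ∈ S, a (S.erase i) = 0) : diff x a S = 0 :=
  CubeComplex.d_apply_eq_zero _ h

theorem map_diff {k N' : Type*} [CommRing k] [Module k N] [AddCommGroup N'] [Module R N']
    [Module k N'] (x : Fin n → R) (g : Finset (Fin n) → N →ₗ[k] N') {S : Finset (Fin n)}
    (hg : ∀ i ∈ S, ∀ z, g S (x i • z) = x i • g (S.erase i) z) (a : Finset (Fin n) → N) :
    g S (diff x a S) = diff x (fun S => g S (a S)) S :=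
  CubeComplex.map_d (M := fun _ => N) (M' := fun _ => N') _ _ g hg a

theorem diff_diff (x : Fin n → R) (a : Finset (Fin n) → N) : diff x (diff x a) = 0 := by
  refine CubeComplex.d_d _ (fun a T i j => ?_) a
  simp only [LinearMap.lsmul_apply]
  rw [smul_comm, erase_right_comm]

/-- Contraction with the `j`-th basis vector. -/
def contract (j : Fin n) (a : Finset (Fin n) → N) (S : Finset (Fin n)) : N :=
  if j ∈ S then 0 else sgn S j • a (insert j S)

theorem contract_mem {P : AddSubgroup N} {j : Fin n} {a : Finset (Fin n) → N}
    {S : Finset (Fin n)} (h : j ∉ S → a (insert j S) ∈ P) : contract j a S ∈ P := by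
  rw [contract]
  split_ifs with hj
  · exact zero_mem _
  · exact zsmul_mem (h hj) _

theorem contract_zero (j : Fin n) : contract j (0 : Finset (Fin n) → N) = 0 := by
  funext S; simp [contract]

/-- A Cartan formula: contraction with the `j`-th basis vector is a homotopy between multiplication
by `x j` and zero. If `j ∈ S`, only the term `i = j` survives; otherwise that term gives `x j • a S`
and all the others cancel by sign. -/
theorem diff_contract_add (x : Fin n → R) (j : Fin n) (a : Finset (Fin n) → N)
    (S : Finset (Fin n)) :
    diff x (contract j a) S + contract j (diff x a) S = x j • a S := by
  by_cases hj : j ∈ S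
  · rw [contract, if_pos hj, add_zero, diff_apply, Finset.sum_eq_single_of_mem j hj]
    · rw [contract, if_neg (notMem_erase j S), insert_erase hj, sgn_erase_of_le le_rfl,
        smul_comm (x j), smul_smul, sgn_mul_self, one_smul]
    · intro i _ hij
      rw [contract, if_pos (mem_erase.2 ⟨hij.symm, hj⟩), smul_zero, smul_zero]
  · rw [contract, if_neg hj, diff_apply, diff_apply, sum_insert hj, erase_insert hj, smul_add,
      smul_smul, ← sgn_erase_of_le (T := insert j S) (le_refl j), erase_insert hj, sgn_mul_self,
      one_smul, add_left_comm, smul_sum, ← sum_add_distrib, Finset.sum_eq_zero, add_zero]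
    intro i hi
    have hij : i ≠ j := fun h => hj (h ▸ hi)
    rw [contract, if_neg (fun h => hj (mem_of_mem_erase h)), erase_insert_of_ne hij.symm,
      smul_comm (x i), smul_smul, smul_smul, ← add_smul]
    convert zero_smul ℤ _ using 2
    have e : sgn S i = sgn ((insert j S).erase j) i := by rw [erase_insert hj]
    rcases lt_or_gt_of_ne hij with h | h
    · rw [sgn_erase_of_lt hi h, e, sgn_erase_of_le h.le]; ring
    · rw [sgn_erase_of_le (T := S) h.le, e, sgn_erase_of_lt (mem_insert_self j S) h]; ring

end Koszul

/-! ### The grading of the localization at a homogeneous element -/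

section AwayGrading

open LaurentPolynomial

variable {k R : Type*} [Field k] [CommRing R] [Algebra k R] (𝒜 : ℕ → Submodule k R)

theorem algebraMap_mem_awayPiece (f : R) (e : ℕ) {a : R} {m : ℤ} (ha : a ∈ intPiece 𝒜 m) :
    algebraMap R (Localization.Away f) a ∈ awayPiece 𝒜 f e m := by
  refine Submodule.subset_span ⟨0, a, by simpa using ha, ?_⟩
  rw [← Localization.mk_one_eq_algebraMap]
  congr 1
  ext; simp

/-- Localizing at `1` changes nothing. The condition `f = 1` is an equation because the intended `f`
is an empty product. -/
theorem algebraMap_mem_awayPiece_iff {f : R} (hf : f = 1) (a : R) (m : ℤ) :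
    algebraMap R (Localization.Away f) a ∈ awayPiece 𝒜 f 0 m ↔ a ∈ intPiece 𝒜 m := by
  subst hf
  refine ⟨fun h => ?_, algebraMap_mem_awayPiece 𝒜 1 0⟩
  have key : ∀ z ∈ awayPiece 𝒜 (1 : R) 0 m, ∃ b ∈ intPiece 𝒜 m, algebraMap R _ b = z := by
    intro z hz
    induction hz using Submodule.span_induction with
    | mem z hz =>
      obtain ⟨N, b, hb, rfl⟩ := hz
      refine ⟨b, by simpa using hb, ?_⟩
      rw [← Localization.mk_one_eq_algebraMap]
      congr 1
      ext; simp
    | zero => exact ⟨0, zero_mem _, map_zero _⟩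
    | add z w _ _ h1 h2 =>
      obtain ⟨b, hb, rfl⟩ := h1
      obtain ⟨c, hc, rfl⟩ := h2
      exact ⟨b + c, add_mem hb hc, map_add _ _ _⟩
    | smul c z _ h =>
      obtain ⟨b, hb, rfl⟩ := h
      exact ⟨c • b, Submodule.smul_mem _ c hb,
        (Algebra.linearMap R (Localization.Away (1 : R))).map_smul_of_tower c b⟩
  obtain ⟨b, hb, hba⟩ := key _ h
  have hinj : Function.Injective (algebraMap R (Localization.Away (1 : R))) :=
    IsLocalization.injective _ (M := Submonoid.powers (1 : R)) (by simp [Submonoid.powers_one])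
  exact hinj hba ▸ hb

variable [GradedAlgebra 𝒜]

/-- The coaction `a ↦ ∑ a_d T ^ d` of a graded algebra, with coefficients in a localization. -/
noncomputable def baseCoaction (f : R) : R →ₐ[k] (Localization.Away f)[T;T⁻¹] :=
  (DirectSum.toAlgebra k (fun i => 𝒜 i)
    (fun i => AddMonoidAlgebra.lsingle (R := k) (i : ℤ) ∘ₗ
      (Algebra.linearMap R (Localization.Away f)).restrictScalars k ∘ₗ (𝒜 i).subtype)
    (by
      change AddMonoidAlgebra.single ((0 : ℕ) : ℤ) (algebraMap R (Localization.Away f) 1) = 1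
      rw [map_one]; rfl)
    (fun {i j} a b => by
      change AddMonoidAlgebra.single ((i + j : ℕ) : ℤ) (algebraMap R (Localization.Away f)
        (a * b)) = AddMonoidAlgebra.single (i : ℤ) (algebraMap R _ (a : R)) *
          AddMonoidAlgebra.single (j : ℤ) (algebraMap R _ (b : R))
      rw [AddMonoidAlgebra.single_mul_single, map_mul, Nat.cast_add])).comp
  (DirectSum.decomposeAlgEquiv 𝒜).toAlgHom

theorem baseCoaction_of_mem (f : R) {a : R} {d : ℕ} (ha : a ∈ 𝒜 d) :
    baseCoaction 𝒜 f a = AddMonoidAlgebra.single (d : ℤ) (algebraMap R _ a) := by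
  have h : (DirectSum.decomposeAlgEquiv 𝒜).toAlgHom a = DirectSum.of _ d ⟨a, ha⟩ :=
    DirectSum.decompose_of_mem 𝒜 ha
  rw [baseCoaction, AlgHom.comp_apply, h, DirectSum.toAlgebra_apply]
  exact DirectSum.toSemiring_of (A := fun i => 𝒜 i) _ _ _ d ⟨a, ha⟩

/-- The coaction sends `f` to `f T ^ e`, with inverse `f⁻¹ T ^ (-e)`. Homogeneity of `f` is what
makes the coaction extend to `R[1/f]`. -/
theorem isUnit_baseCoaction {f : R} {e : ℕ} (hf : f ∈ 𝒜 e) (g : Submonoid.powers f) :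
    IsUnit (baseCoaction 𝒜 f g) := by
  obtain ⟨_, N, rfl⟩ := g
  dsimp only
  rw [map_pow, baseCoaction_of_mem 𝒜 f hf]
  refine IsUnit.pow N ?_
  obtain ⟨u, hu⟩ := IsLocalization.Away.algebraMap_isUnit (S := Localization.Away f) f
  refine IsUnit.of_mul_eq_one (AddMonoidAlgebra.single (-(e : ℤ)) (↑u⁻¹ : Localization.Away f)) ?_
  rw [AddMonoidAlgebra.single_mul_single, ← hu, Units.mul_inv, add_neg_cancel,
    AddMonoidAlgebra.one_def]

/-- The coaction on the localization at a homogeneous element. -/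
noncomputable def coaction {f : R} {e : ℕ} (hf : f ∈ 𝒜 e) :
    Localization.Away f →ₐ[k] (Localization.Away f)[T;T⁻¹] :=
  IsLocalization.liftAlgHom (M := Submonoid.powers f) (isUnit_baseCoaction 𝒜 hf)

theorem coaction_algebraMap {f : R} {e : ℕ} (hf : f ∈ 𝒜 e) (a : R) :
    coaction 𝒜 hf (algebraMap R _ a) = baseCoaction 𝒜 f a := by
  rw [coaction, IsLocalization.liftAlgHom_apply, IsLocalization.lift_eq]; rfl

theorem coaction_algebraMap_of_mem {f : R} {e : ℕ} (hf : f ∈ 𝒜 e) {a : R} {m : ℤ}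
    (ha : a ∈ intPiece 𝒜 m) :
    coaction 𝒜 hf (algebraMap R _ a) = AddMonoidAlgebra.single m (algebraMap R _ a) := by
  rw [coaction_algebraMap]
  cases m with
  | ofNat m => exact baseCoaction_of_mem 𝒜 f ha
  | negSucc m =>
    obtain rfl : a = 0 := ha
    simp

theorem coaction_mk {f : R} {e : ℕ} (hf : f ∈ 𝒜 e) {a : R} {m : ℤ} {N : ℕ}
    (ha : a ∈ intPiece 𝒜 (m + N * e)) :
    coaction 𝒜 hf (Localization.mk a (⟨f ^ N, ⟨N, rfl⟩⟩ : Submonoid.powers f)) =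
      AddMonoidAlgebra.single m
        (Localization.mk a (⟨f ^ N, ⟨N, rfl⟩⟩ : Submonoid.powers f)) := by
  have hu := isUnit_baseCoaction 𝒜 hf ⟨f ^ N, ⟨N, rfl⟩⟩
  have hmk : Localization.mk a (⟨f ^ N, ⟨N, rfl⟩⟩ : Submonoid.powers f) *
      algebraMap R _ (f ^ N) = algebraMap R (Localization.Away f) a := by
    rw [Localization.mk_eq_mk']
    exact IsLocalization.mk'_spec _ _ _
  have hfN : f ^ N ∈ intPiece 𝒜 ((N * e : ℕ) : ℤ) := by
    have := SetLike.pow_mem_graded N hf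
    exact this
  -- After multiplication by the image of `f ^ N`, a unit, both sides are `a T ^ (m + N * e)`.
  refine hu.mul_right_cancel ?_
  rw [← coaction_algebraMap 𝒜 hf, ← map_mul, hmk, coaction_algebraMap_of_mem 𝒜 hf ha,
    coaction_algebraMap_of_mem 𝒜 hf hfN, AddMonoidAlgebra.single_mul_single, hmk]
  push_cast
  rfl

/-- The projection of `R[1/f]` onto its degree `m` piece. -/
noncomputable def awayProj {f : R} {e : ℕ} (hf : f ∈ 𝒜 e) (m : ℤ) :
    Localization.Away f →ₗ[k] Localization.Away f :=
  Finsupp.lapply m ∘ₗ (AddMonoidAlgebra.coeffLinearEquiv k).toLinearMap ∘ₗ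
    (coaction 𝒜 hf).toLinearMap

theorem awayProj_apply {f : R} {e : ℕ} (hf : f ∈ 𝒜 e) (m : ℤ) (z : Localization.Away f) :
    awayProj 𝒜 hf m z = (coaction 𝒜 hf z).coeff m := rfl

theorem coaction_of_mem_awayPiece {f : R} {e : ℕ} (hf : f ∈ 𝒜 e) {m : ℤ}
    {z : Localization.Away f} (hz : z ∈ awayPiece 𝒜 f e m) :
    coaction 𝒜 hf z = AddMonoidAlgebra.single m z := by
  induction hz using Submodule.span_induction with
  | mem z hz => obtain ⟨N, a, ha, rfl⟩ := hz; exact coaction_mk 𝒜 hf ha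
  | zero => simp
  | add z w _ _ h1 h2 => rw [map_add, h1, h2, AddMonoidAlgebra.single_add]
  | smul c z _ h => rw [map_smul, h, AddMonoidAlgebra.smul_single]

theorem awayProj_of_mem {f : R} {e : ℕ} (hf : f ∈ 𝒜 e) {m : ℤ}
    {z : Localization.Away f} (hz : z ∈ awayPiece 𝒜 f e m) (l : ℤ) :
    awayProj 𝒜 hf l z = if l = m then z else 0 := by
  rw [awayProj_apply, coaction_of_mem_awayPiece 𝒜 hf hz, AddMonoidAlgebra.coeff_single,
    Finsupp.single_apply]
  simp only [eq_comm]

theorem awayProj_mem {f : R} {e : ℕ} (hf : f ∈ 𝒜 e) (m : ℤ) (z : Localization.Away f) :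
    awayProj 𝒜 hf m z ∈ awayPiece 𝒜 f e m := by
  induction z using Localization.induction_on with
  | H z =>
  obtain ⟨a, ⟨_, N, rfl⟩⟩ := z
  dsimp only
  induction a using DirectSum.Decomposition.inductionOn 𝒜 with
  | zero => rw [Localization.mk_zero, map_zero]; exact zero_mem _
  | add a b h1 h2 =>
    rw [← Localization.add_mk_self, map_add]
    exact add_mem h1 h2
  | homogeneous a =>
    rename_i i
    have hz : Localization.mk (a : R) (⟨f ^ N, ⟨N, rfl⟩⟩ : Submonoid.powers f) ∈
        awayPiece 𝒜 f e (i - N * e) := by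
      refine Submodule.subset_span ⟨N, a, ?_, rfl⟩
      rw [sub_add_cancel]
      exact a.2
    rw [awayProj_of_mem 𝒜 hf hz]
    split_ifs with h
    · rw [h]; exact hz
    · exact zero_mem _

/-- Membership in a span becomes a fixed-point equation. A differential that commutes with the
projections therefore preserves degrees at once. -/
theorem mem_awayPiece_iff {f : R} {e : ℕ} (hf : f ∈ 𝒜 e) {m : ℤ} {z : Localization.Away f} :
    z ∈ awayPiece 𝒜 f e m ↔ awayProj 𝒜 hf m z = z :=
  ⟨fun h => by rw [awayProj_of_mem 𝒜 hf h, if_pos rfl], fun h => h ▸ awayProj_mem 𝒜 hf m z⟩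

theorem awayProj_mul_of_mem {f : R} {e : ℕ} (hf : f ∈ 𝒜 e) {d : ℤ} {c : Localization.Away f}
    (hc : c ∈ awayPiece 𝒜 f e d) (m : ℤ) (z : Localization.Away f) :
    awayProj 𝒜 hf m (c * z) = c * awayProj 𝒜 hf (m - d) z := by
  rw [awayProj_apply, map_mul, coaction_of_mem_awayPiece 𝒜 hf hc, awayProj_apply,
    AddMonoidAlgebra.coeff_single_mul_eq_mul_coeff (m - d)]
  intro l _
  constructor <;> intro h <;> omega

theorem awayProj_smul_of_mem {f : R} {e : ℕ} (hf : f ∈ 𝒜 e) {d : ℕ} {c : R}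
    (hc : c ∈ 𝒜 d) (m : ℤ) (z : Localization.Away f) :
    awayProj 𝒜 hf m (c • z) = c • awayProj 𝒜 hf (m - d) z := by
  rw [Algebra.smul_def, Algebra.smul_def,
    awayProj_mul_of_mem 𝒜 hf (algebraMap_mem_awayPiece 𝒜 f e (m := d) hc)]

/-- The coactions are natural: two ring homomorphisms out of a localization agree once they agree on
`R`, and there on homogeneous elements. Comparing coefficients of `T ^ m` gives the claim. -/
theorem awayProj_algHom {f f' : R} {e e' : ℕ} (hf : f ∈ 𝒜 e) (hf' : f' ∈ 𝒜 e')
    (g : Localization.Away f →ₐ[R] Localization.Away f') (m : ℤ) (z : Localization.Away f) :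
    awayProj 𝒜 hf' m (g z) = g (awayProj 𝒜 hf m z) := by
  have key : (coaction 𝒜 hf').toRingHom.comp g.toRingHom =
      (AddMonoidAlgebra.mapRingHom ℤ g.toRingHom).comp (coaction 𝒜 hf).toRingHom := by
    refine IsLocalization.ringHom_ext (Submonoid.powers f) (RingHom.ext fun a => ?_)
    induction a using DirectSum.Decomposition.inductionOn 𝒜 with
    | zero => simp
    | add a b h1 h2 => rw [map_add, h1, h2, map_add]
    | homogeneous a =>
      rename_i i
      have h : (a : R) ∈ intPiece 𝒜 (i : ℤ) := a.2
      have hg : g.toRingHom (algebraMap R _ a) = algebraMap R _ (a : R) := g.commutes a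
      change coaction 𝒜 hf' (g.toRingHom (algebraMap R _ a)) =
        AddMonoidAlgebra.mapRingHom ℤ g.toRingHom (coaction 𝒜 hf (algebraMap R _ a))
      rw [hg, coaction_algebraMap_of_mem 𝒜 hf h, coaction_algebraMap_of_mem 𝒜 hf' h,
        AddMonoidAlgebra.mapRingHom_single, hg]
  have := congrArg (fun p => p.coeff m) (RingHom.congr_fun key z)
  rw [awayProj_apply, awayProj_apply]
  refine this.trans ?_
  simp

end AwayGrading

/-! ### Noetherian graded algebras -/

/-- Krull dimension does not grow along integral ring extensions. -/
theorem ringKrullDim_le_of_isIntegral (A B : Type*) [CommRing A] [CommRing B] [Algebra A B]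
    [Algebra.IsIntegral A B] : ringKrullDim B ≤ ringKrullDim A :=
  -- Incomparability: strict inclusions of primes remain strict after contraction.
  Order.krullDim_le_of_strictMono (PrimeSpectrum.comap (algebraMap A B)) fun I J h =>
    Ideal.IsIntegral.comap_lt_comap (I := I.asIdeal) (J := J.asIdeal) h

section Graded

variable {k R : Type*} [Field k] [CommRing R] [Algebra k R] (𝒜 : ℕ → Submodule k R)

theorem mem_of_mem_intPiece {m : ℤ} {b : R} (hb : b ∈ intPiece 𝒜 m) :
    b = 0 ∨ ∃ d : ℕ, m = d ∧ b ∈ 𝒜 d := by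
  cases m with
  | ofNat d => exact Or.inr ⟨d, rfl, hb⟩
  | negSucc d => exact Or.inl hb

variable [GradedAlgebra 𝒜]

/-- Take the degree `d` component of any expression of `f` in terms of the `g i`. The integer degree
makes the coefficient vanish when `e i > d`. -/
theorem exists_eq_sum_mul_of_mem_span {ι : Type*} [Fintype ι] {g : ι → R} {e : ι → ℕ}
    (hg : ∀ i, g i ∈ 𝒜 (e i)) {f : R} {d : ℕ} (hf : f ∈ 𝒜 d)
    (hfg : f ∈ Ideal.span (Set.range g)) :
    ∃ b : ι → R, (∀ i, b i ∈ intPiece 𝒜 ((d : ℤ) - e i)) ∧ f = ∑ i, b i * g i := by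
  obtain ⟨a, ha⟩ := (Submodule.mem_span_range_iff_exists_fun R).1 hfg
  refine ⟨fun i => if e i ≤ d then (DirectSum.decompose 𝒜 (a i) (d - e i) : R) else 0,
    fun i => ?_, ?_⟩
  · dsimp only
    split_ifs with h
    · rw [← Nat.cast_sub h]
      exact (DirectSum.decompose 𝒜 (a i) (d - e i)).2
    · exact zero_mem _
  · have h := congrArg (GradedAlgebra.proj 𝒜 d) ha
    simp only [smul_eq_mul, map_sum, GradedAlgebra.proj_apply,
      fun i => DirectSum.coe_decompose_mul_of_right_mem 𝒜 (a := a i) d (hg i),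
      DirectSum.decompose_of_mem_same 𝒜 hf] at h
    rw [← h]
    exact Finset.sum_congr rfl fun i _ => by dsimp only; split_ifs <;> simp

theorem exists_finite_homogeneous_generators [IsNoetherianRing R] :
    ∃ (t : ℕ) (g : Fin t → R) (e : Fin t → ℕ), (∀ i, g i ∈ 𝒜 (e i)) ∧ (∀ i, 0 < e i) ∧
      Ideal.span (Set.range g) = (HomogeneousIdeal.irrelevant 𝒜).toIdeal := by
  have hfg : (Ideal.span (⋃ i > 0, (𝒜 i : Set R))).FG := IsNoetherian.noetherian _
  obtain ⟨G, hG, hG'⟩ := (Submodule.fg_span_iff_fg_span_finset_subset _).1 hfg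
  have h : ∀ i : Fin (#G), ∃ e : ℕ, 0 < e ∧ (G.equivFin.symm i : R) ∈ 𝒜 e := by
    intro i
    have := hG (G.equivFin.symm i).2
    simpa using this
  choose e he hge using h
  refine ⟨#G, fun i => G.equivFin.symm i, e, hge, he, ?_⟩
  rw [HomogeneousIdeal.irrelevant_eq_span, show Set.range (fun i : Fin (#G) =>
    (G.equivFin.symm i : R)) = (G : Set R) from ?_]
  · exact hG'.symm
  · rw [show (fun i : Fin (#G) => (G.equivFin.symm i : R)) = Subtype.val ∘ G.equivFin.symm from rfl,
      Set.range_comp, G.equivFin.symm.surjective.range_eq]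
    simp

/-- Induction on `d`: for `d > 0`, the piece `𝒜 d` is the sum of the `𝒜 (d - e i) * g i` over
finitely many generators of positive degree. -/
theorem finite_gradedPiece [IsNoetherianRing R] [Module.Finite k (𝒜 0)] (d : ℕ) :
    (𝒜 d).FG := by
  obtain ⟨t, g, e, hg, he, hspan⟩ := exists_finite_homogeneous_generators 𝒜
  induction d using Nat.strong_induction_on with
  | _ d ih =>
  obtain rfl | hd := Nat.eq_zero_or_pos d
  · exact Module.Finite.iff_fg.1 inferInstance
  · let W : Submodule k R := ⨆ i : Fin t, ⨆ _ : e i ≤ d,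
      (𝒜 (d - e i)).map (LinearMap.mulRight k (g i))
    have hW : W.FG := Submodule.fg_iSup _ fun i => Submodule.fg_iSup _ fun hi =>
      (ih _ (by have := he i; omega)).map _
    convert hW
    refine le_antisymm (fun f hf => ?_) (iSup_le fun i => iSup_le fun hi => ?_)
    · obtain ⟨b, hb, rfl⟩ := exists_eq_sum_mul_of_mem_span 𝒜 hg hf
        (hspan ▸ HomogeneousIdeal.mem_irrelevant_of_mem 𝒜 hd hf)
      refine sum_mem fun i _ => ?_
      obtain h0 | ⟨l, hl, hbl⟩ := mem_of_mem_intPiece 𝒜 (hb i)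
      · rw [h0, zero_mul]; exact zero_mem _
      · refine Submodule.mem_iSup_of_mem i (Submodule.mem_iSup_of_mem (by omega)
          ⟨b i, ?_, rfl⟩)
        rwa [show d - e i = l by omega]
    · rintro _ ⟨a, ha, rfl⟩
      have := SetLike.mul_mem_graded (A := 𝒜) ha (hg i)
      rwa [Nat.sub_add_cancel hi] at this

/-- Splitting off one generator of `𝔪` lowers the degree by at most `∑ i, e i`. So elements of
degree above `N * ∑ i, e i` lie in `𝔪 ^ N`, and some power of `𝔪` lies in `I`. -/
theorem exists_gradedPiece_le [IsNoetherianRing R] {I : Ideal R}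
    (hI : (HomogeneousIdeal.irrelevant 𝒜).toIdeal ≤ I.radical) :
    ∃ D, ∀ d ≥ D, ∀ f ∈ 𝒜 d, f ∈ I := by
  obtain ⟨t, g, e, hg, he, hspan⟩ := exists_finite_homogeneous_generators 𝒜
  obtain ⟨N, hN⟩ := Ideal.exists_pow_le_of_le_radical_of_fg hI (IsNoetherian.noetherian _)
  have key : ∀ N d, N * ∑ i, e i < d → ∀ f ∈ 𝒜 d,
      f ∈ (HomogeneousIdeal.irrelevant 𝒜).toIdeal ^ N := by
    intro N
    induction N with
    | zero => simp
    | succ N ih =>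
      intro d hd f hf
      obtain ⟨b, hb, rfl⟩ := exists_eq_sum_mul_of_mem_span 𝒜 hg hf
        (hspan ▸ HomogeneousIdeal.mem_irrelevant_of_mem 𝒜 (by omega) hf)
      refine sum_mem fun i _ => ?_
      rw [pow_succ]
      refine Ideal.mul_mem_mul ?_ (HomogeneousIdeal.mem_irrelevant_of_mem 𝒜 (he i) (hg i))
      obtain h0 | ⟨l, hl, hbl⟩ := mem_of_mem_intPiece 𝒜 (hb i)
      · rw [h0]; exact zero_mem _
      · refine ih l ?_ _ hbl
        have := Finset.single_le_sum (f := e) (fun _ _ => Nat.zero_le _) (Finset.mem_univ i)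
        rw [add_mul, one_mul] at hd
        omega
  exact ⟨N * ∑ i, e i + 1, fun d hd f hf => hN (key N d (by omega) f hf)⟩

/-- A Noetherian graded algebra with finite degree `0` piece is finite over the subalgebra
generated by homogeneous elements of positive degrees that generate the irrelevant ideal up to
radical; so there are at least `dim R` such elements. -/
theorem ringKrullDim_le_card [IsNoetherianRing R] [Module.Finite k (𝒜 0)] {ι : Type*} [Fintype ι]
    {x : ι → R} {δ : ι → ℕ} (hx : ∀ i, x i ∈ 𝒜 (δ i)) (hδ : ∀ i, 0 < δ i)
    (hrad : (HomogeneousIdeal.irrelevant 𝒜).toIdeal ≤ (Ideal.span (Set.range x)).radical) :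
    ringKrullDim R ≤ Fintype.card ι := by
  let _ : Algebra (MvPolynomial ι k) R := (MvPolynomial.aeval (R := k) x).toRingHom.toAlgebra
  have hmap : ∀ p, algebraMap (MvPolynomial ι k) R p = MvPolynomial.aeval x p := fun _ => rfl
  have : IsScalarTower k (MvPolynomial ι k) R := IsScalarTower.of_algebraMap_eq fun c => by
    rw [hmap, MvPolynomial.algebraMap_eq, MvPolynomial.aeval_C]
  obtain ⟨D, hD⟩ := exists_gradedPiece_le 𝒜 hrad
  have hV : (⨆ d : Fin D, 𝒜 d).FG := Submodule.fg_iSup _ fun d => finite_gradedPiece 𝒜 d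
  obtain ⟨F, hF⟩ := hV
  have htop : Submodule.span (MvPolynomial ι k) (F : Set R) = ⊤ := by
    have hle : ∀ v ∈ (⨆ d : Fin D, 𝒜 d), v ∈ Submodule.span (MvPolynomial ι k) (F : Set R) := by
      intro v hv
      rw [← hF] at hv
      exact Submodule.span_le_restrictScalars k (MvPolynomial ι k) _ hv
    -- Graded Nakayama: from degree `D` on, every homogeneous element lies in `(x)`, and since the
    -- `x i` have positive degree the coefficients fall under the induction hypothesis.
    have hmem : ∀ d, ∀ f ∈ 𝒜 d, f ∈ Submodule.span (MvPolynomial ι k) (F : Set R) := by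
      intro d
      induction d using Nat.strong_induction_on with
      | _ d ih =>
      intro f hf
      by_cases hd : d < D
      · exact hle f (Submodule.mem_iSup_of_mem (⟨d, hd⟩ : Fin D) hf)
      · obtain ⟨b, hb, rfl⟩ := exists_eq_sum_mul_of_mem_span 𝒜 hx hf (hD d (by omega) f hf)
        refine sum_mem fun i _ => ?_
        obtain h0 | ⟨l, hl, hbl⟩ := mem_of_mem_intPiece 𝒜 (hb i)
        · rw [h0, zero_mul]; exact zero_mem _
        · have := Submodule.smul_mem _ (MvPolynomial.X i : MvPolynomial ι k)
            (ih l (by have := hδ i; omega) _ hbl)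
          rwa [Algebra.smul_def, hmap, MvPolynomial.aeval_X, mul_comm] at this
    classical
    refine eq_top_iff.2 fun f _ => ?_
    rw [← DirectSum.sum_support_decompose 𝒜 f]
    exact sum_mem fun d _ => hmem d _ (SetLike.coe_mem _)
  have : Module.Finite (MvPolynomial ι k) R := ⟨⟨F, htop⟩⟩
  refine (ringKrullDim_le_of_isIntegral (MvPolynomial ι k) R).trans ?_
  rw [MvPolynomial.ringKrullDim_of_isNoetherianRing, ringKrullDim_eq_zero_of_field, zero_add,
    Nat.card_eq_fintype_card]

/-- The degrees of a homogeneous system of parameters are positive. -/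
theorem IsHomogeneousSystemOfParameters.degree_pos [IsNoetherianRing R]
    [Module.Finite k (𝒜 0)] {n : ℕ} {x : Fin n → R} {δ : Fin n → ℕ}
    (hx : IsHomogeneousSystemOfParameters 𝒜 x δ) (i : Fin n) : 0 < δ i := by
  have hirr : ∀ i, x i ∈ (HomogeneousIdeal.irrelevant 𝒜).toIdeal := fun i =>
    hx.radical_eq ▸ Ideal.le_radical (Ideal.subset_span ⟨i, rfl⟩)
  -- An element of the irrelevant ideal has zero component in degree `0`.
  have hzero : ∀ i, δ i = 0 → x i = 0 := by
    intro i hi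
    have h := (HomogeneousIdeal.mem_irrelevant_iff 𝒜 (x i)).1 (hirr i)
    rw [GradedRing.proj_apply] at h
    rwa [DirectSum.decompose_of_mem_same 𝒜 (hi ▸ hx.homogeneous i)] at h
  by_contra hi
  have hspan : Ideal.span (Set.range x) ≤
      Ideal.span (Set.range fun j : {j // 0 < δ j} => x j) := by
    rw [Ideal.span_le]
    rintro _ ⟨j, rfl⟩
    by_cases hj : 0 < δ j
    · exact Ideal.subset_span ⟨⟨j, hj⟩, rfl⟩
    · rw [hzero j (by omega)]; exact zero_mem _
  -- Discarding the vanishing parameters leaves fewer than `dim R` generators up to radical.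
  have hle := ringKrullDim_le_card 𝒜 (x := fun j : {j // 0 < δ j} => x j) (δ := fun j => δ j)
    (fun j => hx.homogeneous j) (fun j => j.2)
    (hx.radical_eq ▸ Ideal.radical_mono hspan)
  rw [hx.dim_eq] at hle
  have hcard : Fintype.card {j // 0 < δ j} < n := by
    simpa using Fintype.card_subtype_lt (p := fun j => 0 < δ j) hi
  have : n ≤ Fintype.card {j // 0 < δ j} := by exact_mod_cast hle
  omega

end Graded

/-! ### Passing from cohomology classes to cochains -/

theorem Koszul.d_koszulMap {R : Type*} [CommRing R] {n : ℕ} (x : Fin n → R)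
    (a : Finset (Fin n) → R) :
    CubeComplex.d (M := fun _ => R) (koszulMap x) a = Koszul.diff x a := by
  funext S
  rw [CubeComplex.d_apply, Koszul.diff_apply]
  rfl

theorem CubeComplex.exists_sub_eq_d_of_cohomologyPiece_eq_top {k A : Type*} [Field k] [CommRing A]
    [Algebra k A] {s : ℕ} {M : Finset (Fin s) → Type*} [∀ S, AddCommGroup (M S)]
    [∀ S, Module A (M S)] [∀ S, Module k (M S)] [∀ S, IsScalarTower k A (M S)]
    {φ : ∀ (T : Finset (Fin s)) (i : Fin s), M (T.erase i) →ₗ[A] M T}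
    {gr : ∀ S, ℤ → Submodule k (M S)} {r : ℕ} {m : ℤ} (h : cohomologyPiece φ gr r m = ⊤)
    {a : ∀ S, M S} (ha : ∀ S, #S ≠ r → a S = 0) (hda : d φ a = 0) :
    ∃ b c : ∀ S, M S, (∀ S, b S ∈ gr S m) ∧ (∀ S, #S + 1 ≠ r → c S = 0) ∧ a - b = d φ c := by
  have hmem : (coboundaries φ r).mkQ ⟨a, ha, hda⟩ ∈ cohomologyPiece φ gr r m :=
    h ▸ Submodule.mem_top
  obtain ⟨b, hb, hab⟩ := hmem
  obtain ⟨c, hc, hdc⟩ := (Submodule.Quotient.eq (coboundaries φ r)).1 hab.symm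
  exact ⟨b.1, c, fun S => hb S trivial, hc, hdc.symm⟩

theorem neg_one_pow_smul_mem {k R N : Type*} [CommRing k] [CommRing R] [AddCommGroup N] [Module k N]
    [Module R N] (P : Submodule k N) {z : N} (hz : z ∈ P) (p : ℕ) : (-1 : R) ^ p • z ∈ P := by
  rcases neg_one_pow_eq_or R p with h | h
  · rwa [h, one_smul]
  · rw [h, neg_smul, one_smul]; exact neg_mem hz

/-! ### Tensor products of Koszul cocomplexes with cube complexes -/


namespace MixedCochains

section Differentials

variable {R : Type*} [CommRing R] {n s : ℕ} (x : Fin n → R) {M : Finset (Fin s) → Type*}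
  [∀ T, AddCommGroup (M T)] [∀ T, Module R (M T)]

variable (M) in
/-- The Koszul differential of the double complex. -/
noncomputable def dKoszul : (Finset (Fin n) → ∀ T, M T) →ₗ[R] (Finset (Fin n) → ∀ T, M T) :=
  Koszul.diff x

variable (n) in
/-- The second differential of the double complex. -/
noncomputable def dCube (φ : ∀ (T : Finset (Fin s)) (i : Fin s), M (T.erase i) →ₗ[R] M T) :
    (Finset (Fin n) → ∀ T, M T) →ₗ[R] (Finset (Fin n) → ∀ T, M T) :=
  LinearMap.pi fun S => (-1 : R) ^ #S • (CubeComplex.d φ ∘ₗ LinearMap.proj S)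

theorem dKoszul_apply (a : Finset (Fin n) → ∀ T, M T) (S : Finset (Fin n))
    (T : Finset (Fin s)) : dKoszul x M a S T = Koszul.diff x (fun S' => a S' T) S :=
  Koszul.map_diff x (fun _ => LinearMap.proj (R := R) (φ := M) T) (fun _ _ _ => rfl) a

variable (φ : ∀ (T : Finset (Fin s)) (i : Fin s), M (T.erase i) →ₗ[R] M T)

theorem dCube_apply (a : Finset (Fin n) → ∀ T, M T) (S : Finset (Fin n)) :
    dCube n φ a S = (-1 : R) ^ #S • CubeComplex.d φ (a S) := rfl

theorem dCube_apply_eq_zero_iff (a : Finset (Fin n) → ∀ T, M T) (S : Finset (Fin n)) :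
    dCube n φ a S = 0 ↔ CubeComplex.d φ (a S) = 0 := by
  rw [dCube_apply]
  rcases neg_one_pow_eq_or R #S with h | h <;> simp [h]

theorem dKoszul_dKoszul (a : Finset (Fin n) → ∀ T, M T) :
    dKoszul x M (dKoszul x M a) = 0 :=
  Koszul.diff_diff x a

theorem dCube_dCube (hφ : ∀ a, CubeComplex.d φ (CubeComplex.d φ a) = 0)
    (a : Finset (Fin n) → ∀ T, M T) : dCube n φ (dCube n φ a) = 0 := by
  funext S
  rw [dCube_apply, dCube_apply, map_smul, hφ, smul_zero, smul_zero]
  rfl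

/-- The cube differential is `R`-linear and so commutes with multiplication by `x i`. The sign `(-1)
^ #S` flips because the Koszul differential changes `#S` by one. -/
theorem dCube_dKoszul (a : Finset (Fin n) → ∀ T, M T) :
    dCube n φ (dKoszul x M a) = -dKoszul x M (dCube n φ a) := by
  funext S
  rw [dCube_apply, Pi.neg_apply, dKoszul, Koszul.diff_apply, Koszul.diff_apply, map_sum, smul_sum,
    ← sum_neg_distrib]
  refine Finset.sum_congr rfl fun i hi => ?_
  rw [dCube_apply, map_zsmul, map_smul, ← card_erase_add_one hi, pow_succ, mul_neg_one, neg_smul,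
    smul_comm (x i) ((-1 : R) ^ _), smul_comm (CubeComplex.sgn S i) ((-1 : R) ^ _)]

theorem dKoszul_dCube (a : Finset (Fin n) → ∀ T, M T) :
    dKoszul x M (dCube n φ a) = -dCube n φ (dKoszul x M a) := by
  rw [dCube_dKoszul, neg_neg]

end Differentials

section Graded

variable {k R : Type*} [Field k] [CommRing R] {n s : ℕ} {M : Finset (Fin s) → Type*}
  [∀ T, AddCommGroup (M T)] [∀ T, Module R (M T)] [∀ T, Module k (M T)]

/-- The term of bidegree `(p, q)` of the double complex; more precisely the part of it that
consists of the families with entries in given subspaces. -/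
def term (P : Finset (Fin n) → ∀ T, Submodule k (M T)) (p q : ℕ) :
    Submodule k (Finset (Fin n) → ∀ T, M T) where
  carrier := {a | (∀ S T, #S ≠ p → a S T = 0) ∧ (∀ S T, #T ≠ q → a S T = 0) ∧
    ∀ S T, a S T ∈ P S T}
  zero_mem' := ⟨fun _ _ _ => rfl, fun _ _ _ => rfl, fun _ _ => zero_mem _⟩
  add_mem' := by
    rintro a b ⟨a1, a2, a3⟩ ⟨b1, b2, b3⟩
    exact ⟨fun S T h => by simp [a1 S T h, b1 S T h], fun S T h => by simp [a2 S T h, b2 S T h],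
      fun S T => add_mem (a3 S T) (b3 S T)⟩
  smul_mem' := by
    rintro c a ⟨a1, a2, a3⟩
    exact ⟨fun S T h => by simp [a1 S T h], fun S T h => by simp [a2 S T h],
      fun S T => Submodule.smul_mem _ c (a3 S T)⟩

variable {x : Fin n → R} {P : Finset (Fin n) → ∀ T, Submodule k (M T)}
  {φ : ∀ (T : Finset (Fin s)) (i : Fin s), M (T.erase i) →ₗ[R] M T}

theorem dKoszul_mem_term
    (hP : ∀ T (a : Finset (Fin n) → M T), (∀ S, a S ∈ P S T) → ∀ S, Koszul.diff x a S ∈ P S T)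
    {p q : ℕ} {a : Finset (Fin n) → ∀ T, M T} (ha : a ∈ term P p q) :
    dKoszul x M a ∈ term P (p + 1) q := by
  obtain ⟨a1, a2, a3⟩ := ha
  refine ⟨fun S T h => ?_, fun S T h => ?_, fun S T => ?_⟩
  · rw [dKoszul_apply]
    exact Koszul.diff_apply_eq_zero x fun i hi =>
      a1 _ _ fun h' => h (by rw [← h', card_erase_add_one hi])
  · rw [dKoszul_apply]
    exact Koszul.diff_apply_eq_zero x fun i hi => a2 _ _ h
  · rw [dKoszul_apply]
    exact hP T _ (fun S => a3 S T) S

theorem dCube_mem_term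
    (hP : ∀ S (a : ∀ T, M T), (∀ T, a T ∈ P S T) → ∀ T, CubeComplex.d φ a T ∈ P S T)
    {p q : ℕ} {a : Finset (Fin n) → ∀ T, M T} (ha : a ∈ term P p q) :
    dCube n φ a ∈ term P p (q + 1) := by
  obtain ⟨a1, a2, a3⟩ := ha
  refine ⟨fun S T h => ?_, fun S T h => ?_, fun S T => ?_⟩
  · rw [dCube_apply, show a S = 0 from funext fun T => a1 S T h, map_zero, smul_zero]; rfl
  · rw [dCube_apply, Pi.smul_apply, CubeComplex.d_apply_eq_zero, smul_zero]
    exact fun i hi => a2 _ _ fun h' => h (by rw [← h', card_erase_add_one hi])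
  · exact neg_one_pow_smul_mem _ (hP S _ (fun T => a3 S T) T) _

variable [Algebra k R] [∀ T, IsScalarTower k R (M T)]

/-- The Koszul differential does not mix different `T`, so preimages can be chosen for each `T`
separately and taken to be `0` when `#T ≠ q`. -/
theorem exactAtTerm_dKoszul {p q : ℕ}
    (hex : ∀ T, #T = q → ∀ a : Finset (Fin n) → M T, (∀ S, #S ≠ p → a S = 0) →
      (∀ S, a S ∈ P S T) → Koszul.diff x a = 0 →
      ∃ b : Finset (Fin n) → M T, (∀ S, #S + 1 ≠ p → b S = 0) ∧ (∀ S, b S ∈ P S T) ∧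
        Koszul.diff x b = a) :
    ExactAtTerm (fun p => term P p q) ((dKoszul x M).restrictScalars k) p := by
  refine exactAtTerm_of_exists ?_
  rintro a ⟨a1, a2, a3⟩ hda
  have h : ∀ T, ∃ b : Finset (Fin n) → M T, (∀ S, #S + 1 ≠ p → b S = 0) ∧ (#T ≠ q → b = 0) ∧
      (∀ S, b S ∈ P S T) ∧ Koszul.diff x b = fun S => a S T := by
    intro T
    by_cases hT : #T = q
    · obtain ⟨b, b1, b2, b3⟩ := hex T hT (fun S => a S T) (fun S hS => a1 S T hS)
        (fun S => a3 S T)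
        (funext fun S => (dKoszul_apply x a S T).symm.trans (congrFun (congrFun hda S) T))
      exact ⟨b, b1, fun h => absurd hT h, b2, b3⟩
    · exact ⟨0, fun _ _ => rfl, fun _ => rfl, fun _ => zero_mem _, by
        rw [map_zero]; funext S; exact (a2 S T hT).symm⟩
  choose b b1 b2 b3 b4 using h
  refine ⟨fun S T => b T S, fun hp => funext fun S => funext fun T => b1 T S (by omega),
    fun p' hp => ⟨fun S T h => b1 T S (by omega), fun S T h => congrFun (b2 T h) S,
      fun S T => b3 T S⟩, funext fun S => funext fun T => ?_⟩
  exact (dKoszul_apply x (fun S T => b T S) S T).trans (congrFun (b4 T) S)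

theorem exactAtTerm_dCube {p q : ℕ}
    (hex : ∀ S, #S = p → ∀ a : ∀ T, M T, (∀ T, #T ≠ q → a T = 0) →
      (∀ T, a T ∈ P S T) → CubeComplex.d φ a = 0 →
      ∃ b : ∀ T, M T, (∀ T, #T + 1 ≠ q → b T = 0) ∧ (∀ T, b T ∈ P S T) ∧
        CubeComplex.d φ b = a) :
    ExactAtTerm (term P p) ((dCube n φ).restrictScalars k) q := by
  refine exactAtTerm_of_exists ?_
  rintro a ⟨a1, a2, a3⟩ hda
  have h : ∀ S, ∃ b : ∀ T, M T, (∀ T, #T + 1 ≠ q → b T = 0) ∧ (#S ≠ p → b = 0) ∧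
      (∀ T, b T ∈ P S T) ∧ (-1 : R) ^ #S • CubeComplex.d φ b = a S := by
    intro S
    by_cases hS : #S = p
    · obtain ⟨b, b1, b2, b3⟩ := hex S hS (a S) (fun T hT => a2 S T hT)
        (fun T => a3 S T) ((dCube_apply_eq_zero_iff φ a S).1 (congrFun hda S))
      refine ⟨(-1 : R) ^ #S • b, fun T hT => ?_, fun h => absurd hS h,
        fun T => neg_one_pow_smul_mem _ (b2 T) _, ?_⟩
      · rw [Pi.smul_apply, b1 T hT, smul_zero]
      · rw [map_smul, b3, smul_smul, ← pow_add, Even.neg_one_pow ⟨_, rfl⟩, one_smul]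
    · exact ⟨0, fun _ _ => rfl, fun _ => rfl, fun _ => zero_mem _, by
        rw [map_zero, smul_zero]; funext T; exact (a1 S T hS).symm⟩
  choose b b1 b2 b3 b4 using h
  exact ⟨b, fun hq => funext fun S => funext fun T => b1 S T (by omega),
    fun q' hq => ⟨fun S T h => congrFun (b2 S h) T, fun S T h => b1 S T (by omega), b3⟩,
    funext b4⟩

/-! #### The edge maps -/

variable (x P φ)

/-- The cocycles of the total complex. -/
noncomputable abbrev total (r : ℕ) : Submodule k (ℕ → ℕ → Finset (Fin n) → ∀ T, M T) :=
  Bicomplex.totalCocycles (term P) ((dKoszul x M).restrictScalars k)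
    ((dCube n φ).restrictScalars k) r

/-- The edge map from the total cocycles to the cohomology of the cube complex. -/
noncomputable def toCube (r : ℕ) : total x P φ r →ₗ[k] CubeComplex.Cohomology φ r :=
  (CubeComplex.coboundaries φ r).mkQ.restrictScalars k ∘ₗ
    { toFun := fun z => ⟨z.1 0 r ∅, fun T hT => (z.2.1 0 r).2.1 ∅ T hT,
        (dCube_apply_eq_zero_iff φ _ _).1 (congrFun (z.2.2.2.2.1 r) ∅)⟩
      map_add' := fun _ _ => rfl
      map_smul' := fun _ _ => rfl }

variable {x P φ}

theorem toCube_eq_zero_iff {r : ℕ} (z : total x P φ r) :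
    toCube x P φ r z = 0 ↔
      ∃ c : ∀ T, M T, (∀ T, #T + 1 ≠ r → c T = 0) ∧ CubeComplex.d φ c = z.1 0 r ∅ :=
  Submodule.Quotient.mk_eq_zero _

theorem dCube_single_empty (a : ∀ T, M T) :
    dCube n φ (Pi.single ∅ a) = Pi.single ∅ (CubeComplex.d φ a) := by
  funext S
  by_cases hS : S = ∅
  · subst hS; simp [dCube_apply]
  · simp [dCube_apply, Pi.single_eq_of_ne hS]

theorem single_empty_mem_term {r : ℕ} {a : ∀ T, M T} (ha0 : ∀ T, #T ≠ r → a T = 0)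
    (ha : ∀ T, a T ∈ P ∅ T) : (Pi.single ∅ a : Finset (Fin n) → ∀ T, M T) ∈ term P 0 r := by
  refine ⟨fun S T h => ?_, fun S T h => ?_, fun S T => ?_⟩
  · rw [Pi.single_eq_of_ne (by simpa using h)]; rfl
  · by_cases hS : S = ∅
    · subst hS; simpa using ha0 T h
    · rw [Pi.single_eq_of_ne hS]; rfl
  · by_cases hS : S = ∅
    · subst hS; simpa using ha T
    · rw [Pi.single_eq_of_ne hS]; exact zero_mem _

theorem eq_single_empty_of_mem_term {r : ℕ} {a : Finset (Fin n) → ∀ T, M T}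
    (ha : a ∈ term P 0 r) : a = Pi.single ∅ (a ∅) := by
  funext S
  by_cases hS : S = ∅
  · subst hS; simp
  · rw [Pi.single_eq_of_ne hS]
    exact funext fun T => ha.1 S T (by simpa using hS)

end Graded

end MixedCochains

/-! ### Images and kernels of the two edge maps -/

namespace MixedCochains

section Edges

variable {k R : Type*} [Field k] [CommRing R] {n s : ℕ} {M : Finset (Fin s) → Type*}
  [∀ T, AddCommGroup (M T)] [∀ T, Module R (M T)] [∀ T, Module k (M T)]
  {x : Fin n → R} {P : Finset (Fin n) → ∀ T, Submodule k (M T)}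
  {φ : ∀ (T : Finset (Fin s)) (i : Fin s), M (T.erase i) →ₗ[R] M T}

/-- The Koszul cochains as a part of the double complex. -/
def ofKoszul (e : R ≃ₗ[R] M ∅) (a : Finset (Fin n) → R) (S : Finset (Fin n)) : ∀ T, M T :=
  Pi.single ∅ (e (a S))

theorem dKoszul_ofKoszul (e : R ≃ₗ[R] M ∅) (a : Finset (Fin n) → R) :
    dKoszul x M (ofKoszul e a) = ofKoszul e (Koszul.diff x a) := by
  funext S
  refine (Koszul.map_diff x (fun _ => LinearMap.single R M ∅ ∘ₗ e.toLinearMap)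
    (fun i _ w => map_smul _ (x i) w) a).symm

theorem ofKoszul_zero (e : R ≃ₗ[R] M ∅) : ofKoszul (n := n) e 0 = 0 := by
  funext S
  simp [ofKoszul]

theorem ofKoszul_mem_term {e : R ≃ₗ[R] M ∅} {r : ℕ} {a : Finset (Fin n) → R}
    (ha0 : ∀ S, #S ≠ r → a S = 0) (ha : ∀ S, e (a S) ∈ P S ∅) : ofKoszul e a ∈ term P r 0 := by
  refine ⟨fun S T h => ?_, fun S T h => ?_, fun S T => ?_⟩
  · rw [ofKoszul, ha0 S h, map_zero, Pi.single_zero]; rfl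
  · rw [ofKoszul, Pi.single_eq_of_ne (by simpa using h)]
  · by_cases hT : T = ∅
    · subst hT; rw [ofKoszul, Pi.single_eq_same]; exact ha S
    · rw [ofKoszul, Pi.single_eq_of_ne hT]; exact zero_mem _

theorem eq_ofKoszul_of_mem_term (e : R ≃ₗ[R] M ∅) {r : ℕ} {a : Finset (Fin n) → ∀ T, M T}
    (ha : a ∈ term P r 0) : a = ofKoszul e (fun S => e.symm (a S ∅)) := by
  funext S T
  by_cases hT : T = ∅
  · subst hT; rw [ofKoszul, Pi.single_eq_same, e.apply_symm_apply]
  · rw [ofKoszul, Pi.single_eq_of_ne hT]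
    exact ha.2.1 S T (by simpa using hT)

variable [Algebra k R] [∀ T, IsScalarTower k R (M T)]

/-- A cocycle of row `0` with entries in `P` extends along a staircase to a total cocycle, because
the other rows are exact in the range needed. -/
theorem range_toCube {N r : ℕ} (hr : r < N)
    (hPx : ∀ T (a : Finset (Fin n) → M T), (∀ S, a S ∈ P S T) → ∀ S, Koszul.diff x a S ∈ P S T)
    (hrow : ∀ p q, q < N → ExactAtTerm (term P (p + 1)) ((dCube n φ).restrictScalars k) q)
    {gr : ∀ T, ℤ → Submodule k (M T)} {m : ℤ} (hgr : ∀ T, gr T m = P ∅ T) :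
    LinearMap.range (toCube x P φ r) = CubeComplex.cohomologyPiece φ gr r m := by
  apply le_antisymm
  · rintro _ ⟨z, rfl⟩
    refine ⟨_, fun T _ => ?_, rfl⟩
    change z.1 0 r ∅ T ∈ gr T m
    rw [hgr]
    exact (z.2.1 0 r).2.2 ∅ T
  · rintro _ ⟨b, hb, rfl⟩
    have hb' : ∀ T, b.1 T ∈ P ∅ T := fun T => hgr T ▸ hb T trivial
    have hdb : dCube n φ (Pi.single ∅ b.1) = 0 := by
      rw [dCube_single_empty, b.2.2, Pi.single_zero]
    obtain ⟨z, hz, hzb⟩ := Bicomplex.exists_mem_totalCocycles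
      (d₁ := (dKoszul x M).restrictScalars k) (d₂ := (dCube n φ).restrictScalars k)
      (dKoszul_dKoszul x) (dCube_dKoszul x φ) (fun p q a ha => dKoszul_mem_term hPx ha) hrow hr
      (single_empty_mem_term b.2.1 hb') hdb
    refine ⟨⟨z, hz⟩, congrArg (CubeComplex.coboundaries φ r).mkQ (Subtype.ext ?_)⟩
    change z 0 r ∅ = b.1
    rw [hzb, Pi.single_eq_same]

/-- A class vanishes as soon as some cochain bounds it, possibly one with entries outside `P`. The
hypothesis `hproj` replaces it by one inside the double complex, where the staircase can start. -/
theorem toCube_eq_zero_iff_isTotalCoboundary {N r : ℕ} (hr : r < N)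
    (hPx : ∀ T (a : Finset (Fin n) → M T), (∀ S, a S ∈ P S T) → ∀ S, Koszul.diff x a S ∈ P S T)
    (hrow : ∀ p q, q < N → ExactAtTerm (term P (p + 1)) ((dCube n φ).restrictScalars k) q)
    (hproj : ∀ c : ∀ T, M T, (∀ T, #T + 1 ≠ r → c T = 0) →
      (∀ T, CubeComplex.d φ c T ∈ P ∅ T) → ∃ c' : ∀ T, M T, (∀ T, #T + 1 ≠ r → c' T = 0) ∧
        (∀ T, c' T ∈ P ∅ T) ∧ CubeComplex.d φ c' = CubeComplex.d φ c) (z : total x P φ r) :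
    toCube x P φ r z = 0 ↔ Bicomplex.IsTotalCoboundary (term P)
      ((dKoszul x M).restrictScalars k) ((dCube n φ).restrictScalars k) r z.1 := by
  rw [toCube_eq_zero_iff]
  constructor
  · rintro ⟨c, hc, hcz⟩
    have hz := eq_single_empty_of_mem_term (z.2.1 0 r)
    refine Bicomplex.isTotalCoboundary_of_row_zero
      (d₁ := (dKoszul x M).restrictScalars k) (d₂ := (dCube n φ).restrictScalars k)
      (dKoszul_dKoszul x) (dCube_dKoszul x φ) (fun p q a ha => dKoszul_mem_term hPx ha) hrow hr
      z.2 ?_ fun q hq => ?_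
    · obtain rfl | h0 := eq_or_ne r 0
      · rw [hz, ← hcz, show c = 0 from funext fun T => hc T (by omega), map_zero, Pi.single_zero]
      · exact z.2.2.1 0 0 (by omega)
    · obtain ⟨c', hc1, hc2, hc3⟩ := hproj c hc fun T => hcz ▸ (z.2.1 0 r).2.2 ∅ T
      refine ⟨Pi.single ∅ c', single_empty_mem_term (fun T hT => hc1 T (by omega)) hc2, ?_⟩
      rw [hz, ← hcz, ← hc3]
      exact (dCube_single_empty c').symm
  · rintro ⟨c, h1, h2, h3, h4, h5, h6⟩
    cases r with
    | zero => exact ⟨0, fun _ _ => rfl, by rw [map_zero, h3]; rfl⟩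
    | succ q =>
      refine ⟨c 0 q ∅, fun T hT => (h1 0 q).2.1 ∅ T (by omega), ?_⟩
      rw [h5 q]
      change _ = dCube n φ (c 0 q) ∅
      rw [dCube_apply, card_empty, pow_zero, one_smul]

variable (x P φ) in
/-- The edge map from the total cocycles to the Koszul cohomology. -/
noncomputable def toKoszul (e : R ≃ₗ[R] M ∅) (r : ℕ) :
    total x P φ r →ₗ[k] KoszulCohomology x r :=
  (CubeComplex.coboundaries (M := fun _ => R) (koszulMap x) r).mkQ.restrictScalars k ∘ₗ
    { toFun := fun z => ⟨fun S => e.symm (z.1 r 0 S ∅),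
        fun S hS => (congrArg e.symm ((z.2.1 r 0).1 S ∅ hS)).trans (map_zero _), by
          rw [Koszul.d_koszulMap]
          funext S
          have h := congrFun (congrFun (z.2.2.2.1 r) S) ∅
          refine (Koszul.map_diff x (fun _ => e.symm.toLinearMap)
            (fun i _ w => map_smul e.symm (x i) w) (fun S => z.1 r 0 S ∅)).symm.trans ?_
          rw [← dKoszul_apply]
          exact (congrArg e.symm h).trans (map_zero _)⟩
      map_add' := fun z w => Subtype.ext (funext fun S => map_add e.symm _ _)
      map_smul' := fun c z => Subtype.ext (funext fun S =>
        e.symm.toLinearMap.map_smul_of_tower c (z.1 r 0 S ∅)) }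

theorem toKoszul_eq_zero_iff {e : R ≃ₗ[R] M ∅} {r : ℕ} (z : total x P φ r) :
    toKoszul x P φ e r z = 0 ↔ ∃ c : Finset (Fin n) → R, (∀ S, #S + 1 ≠ r → c S = 0) ∧
      Koszul.diff x c = fun S => e.symm (z.1 r 0 S ∅) := by
  simp only [← Koszul.d_koszulMap]
  exact Submodule.Quotient.mk_eq_zero _

/-- The zigzag for the other edge, applied to the transposed double complex. -/
theorem range_toKoszul {r : ℕ} (e : R ≃ₗ[R] M ∅)
    (hφ : ∀ a, CubeComplex.d φ (CubeComplex.d φ a) = 0)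
    (hPφ : ∀ S (a : ∀ T, M T), (∀ T, a T ∈ P S T) → ∀ T, CubeComplex.d φ a T ∈ P S T)
    (hcol : ∀ p q, ExactAtTerm (fun p => term P p (q + 1)) ((dKoszul x M).restrictScalars k) p)
    {gr : Finset (Fin n) → ℤ → Submodule k R} {m : ℤ}
    (hgr : ∀ S a, a ∈ gr S m ↔ e a ∈ P S ∅) :
    LinearMap.range (toKoszul x P φ e r) =
      CubeComplex.cohomologyPiece (M := fun _ => R) (koszulMap x) gr r m := by
  apply le_antisymm
  · rintro _ ⟨z, rfl⟩
    refine ⟨_, fun S _ => (hgr S _).2 ?_, rfl⟩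
    change e (e.symm (z.1 r 0 S ∅)) ∈ _
    rw [e.apply_symm_apply]
    exact (z.2.1 r 0).2.2 S ∅
  · rintro _ ⟨b, hb, rfl⟩
    have hb' : ∀ S, e (b.1 S) ∈ P S ∅ := fun S => (hgr S _).1 (hb S trivial)
    have hdb : dKoszul x M (ofKoszul e b.1) = 0 := by
      rw [dKoszul_ofKoszul, ← Koszul.d_koszulMap, b.2.2, ofKoszul_zero]
    -- The columns are exact in every degree, so any bound above `r` will do.
    obtain ⟨z, hz, hzb⟩ := Bicomplex.exists_mem_totalCocycles (n := r + 1)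
      (B := fun p q => term P q p)
      (d₁ := (dCube n φ).restrictScalars k) (d₂ := (dKoszul x M).restrictScalars k)
      (dCube_dCube φ hφ) (dKoszul_dCube x φ) (fun p q a ha => dCube_mem_term hPφ ha)
      (fun p q _ => hcol q p) (Nat.lt_succ_self r) (ofKoszul_mem_term b.2.1 hb') hdb
    refine ⟨⟨_, Bicomplex.mem_totalCocycles_swap hz⟩,
      congrArg (CubeComplex.coboundaries (M := fun _ => R) (koszulMap x) r).mkQ
        (Subtype.ext (funext fun S => ?_))⟩
    change e.symm (z 0 r S ∅) = b.1 S
    rw [hzb, ofKoszul, Pi.single_eq_same, e.symm_apply_apply]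

theorem toKoszul_eq_zero_iff_isTotalCoboundary {r : ℕ} (e : R ≃ₗ[R] M ∅)
    (hφ : ∀ a, CubeComplex.d φ (CubeComplex.d φ a) = 0)
    (hPφ : ∀ S (a : ∀ T, M T), (∀ T, a T ∈ P S T) → ∀ T, CubeComplex.d φ a T ∈ P S T)
    (hcol : ∀ p q, ExactAtTerm (fun p => term P p (q + 1)) ((dKoszul x M).restrictScalars k) p)
    (hproj : ∀ c : Finset (Fin n) → R, (∀ S, #S + 1 ≠ r → c S = 0) →
      (∀ S, e (Koszul.diff x c S) ∈ P S ∅) → ∃ c' : Finset (Fin n) → R,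
        (∀ S, #S + 1 ≠ r → c' S = 0) ∧ (∀ S, e (c' S) ∈ P S ∅) ∧
          Koszul.diff x c' = Koszul.diff x c) (z : total x P φ r) :
    toKoszul x P φ e r z = 0 ↔ Bicomplex.IsTotalCoboundary (term P)
      ((dKoszul x M).restrictScalars k) ((dCube n φ).restrictScalars k) r z.1 := by
  rw [toKoszul_eq_zero_iff]
  constructor
  · rintro ⟨c, hc, hcz⟩
    have hz := eq_ofKoszul_of_mem_term e (z.2.1 r 0)
    refine Bicomplex.IsTotalCoboundary.swap (Bicomplex.isTotalCoboundary_of_row_zero (n := r + 1)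
      (B := fun p q => term P q p)
      (d₁ := (dCube n φ).restrictScalars k) (d₂ := (dKoszul x M).restrictScalars k)
      (dCube_dCube φ hφ) (dKoszul_dCube x φ) (fun p q a ha => dCube_mem_term hPφ ha)
      (fun p q _ => hcol q p) (Nat.lt_succ_self r) (Bicomplex.mem_totalCocycles_swap z.2)
      ?_ fun q hq => ?_)
    · obtain rfl | h0 := eq_or_ne r 0
      · change z.1 0 0 = 0
        rw [hz, ← hcz, show c = 0 from funext fun T => hc T (by omega), map_zero, ofKoszul_zero]
      · exact z.2.2.1 0 0 (by omega)
    · obtain ⟨c', hc1, hc2, hc3⟩ := hproj c hc fun S => by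
        rw [hcz, e.apply_symm_apply]
        exact (z.2.1 r 0).2.2 S ∅
      refine ⟨ofKoszul e c', ofKoszul_mem_term (fun T hT => hc1 T (by omega)) hc2, ?_⟩
      change z.1 r 0 = dKoszul x M (ofKoszul e c')
      rw [hz, ← hcz, ← hc3, dKoszul_ofKoszul]
  · rintro ⟨c, h1, h2, h3, h4, h5, h6⟩
    cases r with
    | zero => exact ⟨0, fun _ _ => rfl, by rw [map_zero, h3]; funext S; simp⟩
    | succ q =>
      refine ⟨fun S => e.symm (c q 0 S ∅),
        fun S hS => (congrArg e.symm ((h1 q 0).1 S ∅ (by omega))).trans (map_zero _), ?_⟩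
      funext S
      rw [h4 q]
      refine (Koszul.map_diff x (fun _ => e.symm.toLinearMap)
        (fun i _ w => map_smul e.symm (x i) w) (fun S => c q 0 S ∅)).symm.trans ?_
      rw [← dKoszul_apply]
      rfl

end Edges

end MixedCochains

/-! ### The double complex of the Koszul and Cech complexes -/

section CechMap

variable {R : Type*} [CommRing R] {s : ℕ}

theorem isUnit_algebraMap_prod (y : Fin s → R) {U T : Finset (Fin s)} (h : U ⊆ T)
    (g : Submonoid.powers (∏ j ∈ U, y j)) :
    IsUnit (Algebra.ofId R (Localization.Away (∏ j ∈ T, y j)) g) := by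
  obtain ⟨_, N, rfl⟩ := g
  have h : IsUnit (algebraMap R (Localization.Away (∏ j ∈ T, y j)) (∏ j ∈ U, y j)) :=
    isUnit_of_dvd_unit (map_dvd _ (Finset.prod_dvd_prod_of_subset _ _ _ h))
      (IsLocalization.Away.algebraMap_isUnit (∏ j ∈ T, y j))
  simpa [Algebra.ofId_apply] using h.pow N

/-- The localization map `R[1 / ∏_{j ∈ U} y j] → R[1 / ∏_{j ∈ T} y j]` for `U ⊆ T`. -/
noncomputable def cechIncl (y : Fin s → R) {U T : Finset (Fin s)} (h : U ⊆ T) :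
    Localization.Away (∏ j ∈ U, y j) →ₐ[R] Localization.Away (∏ j ∈ T, y j) :=
  IsLocalization.liftAlgHom (M := Submonoid.powers (∏ j ∈ U, y j)) (isUnit_algebraMap_prod y h)

theorem cechMap_eq (y : Fin s → R) (T : Finset (Fin s)) (i : Fin s) :
    cechMap y T i = (cechIncl y (erase_subset i T)).toLinearMap := rfl

theorem cechIncl_comp (y : Fin s → R) {U V T : Finset (Fin s)} (h : U ⊆ V) (h' : V ⊆ T)
    (z : Localization.Away (∏ j ∈ U, y j)) :
    cechIncl y h' (cechIncl y h z) = cechIncl y (h.trans h') z := by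
  have := IsLocalization.algHom_subsingleton (Submonoid.powers (∏ j ∈ U, y j))
    (R := R) (S := Localization.Away (∏ j ∈ U, y j)) (P := Localization.Away (∏ j ∈ T, y j))
  exact DFunLike.congr_fun
    (Subsingleton.elim ((cechIncl y h').comp (cechIncl y h)) (cechIncl y (h.trans h'))) z

theorem cech_d_d (y : Fin s → R) (a : ∀ T, Localization.Away (∏ j ∈ T, y j)) :
    CubeComplex.d (cechMap y) (CubeComplex.d (cechMap y) a) = 0 := by
  refine CubeComplex.d_d _ (fun a T i j => ?_) a
  simp only [cechMap_eq, AlgHom.toLinearMap_apply, cechIncl_comp]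
  -- The two subsets are variables, so that the equality of iterated erasures can be substituted
  -- despite the dependent types.
  have key : ∀ (U U' : Finset (Fin s)) (h : U ⊆ T) (h' : U' ⊆ T), U = U' →
      cechIncl y h (a U) = cechIncl y h' (a U') := by
    rintro U _ h h' rfl; rfl
  exact key _ _ _ _ erase_right_comm

end CechMap

/-! ### Homogeneous cochains and exactness of rows and columns -/

section GradedCech

variable {k R : Type*} [Field k] [CommRing R] [Algebra k R] (𝒜 : ℕ → Submodule k R)
  {n s : ℕ} {x : Fin n → R} {y : Fin s → R} {ε : Fin s → ℕ} {δ : Fin n → ℕ}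

/-- The localization at the empty product. -/
noncomputable def awayEmptyEquiv (y : Fin s → R) :
    R ≃ₗ[R] Localization.Away (∏ j ∈ (∅ : Finset (Fin s)), y j) :=
  (IsLocalization.atUnit R (Localization.Away (∏ j ∈ (∅ : Finset (Fin s)), y j))
    (∏ j ∈ (∅ : Finset (Fin s)), y j) (by simp)).toLinearEquiv

theorem awayEmptyEquiv_apply (y : Fin s → R) (a : R) :
    awayEmptyEquiv y a = algebraMap R _ a :=
  (IsLocalization.atUnit R (Localization.Away (∏ j ∈ (∅ : Finset (Fin s)), y j))
    (∏ j ∈ (∅ : Finset (Fin s)), y j) (by simp)).commutes a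

theorem awayEmptyEquiv_mem_iff (y : Fin s → R) (ε : Fin s → ℕ) (a : R) (m : ℤ) :
    awayEmptyEquiv y a ∈ awayPiece 𝒜 (∏ j ∈ (∅ : Finset (Fin s)), y j) (∑ j ∈ ∅, ε j) m ↔
      a ∈ intPiece 𝒜 m := by
  rw [awayEmptyEquiv_apply]
  exact algebraMap_mem_awayPiece_iff 𝒜 Finset.prod_empty a m

variable [GradedAlgebra 𝒜]

theorem prod_mem_graded (hy : ∀ j, y j ∈ 𝒜 (ε j)) (T : Finset (Fin s)) :
    ∏ j ∈ T, y j ∈ 𝒜 (∑ j ∈ T, ε j) :=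
  SetLike.prod_mem_graded 𝒜 ε y fun j _ => hy j

theorem awayProj_d_cechMap (hy : ∀ j, y j ∈ 𝒜 (ε j)) (m : ℤ)
    (a : ∀ T, Localization.Away (∏ j ∈ T, y j)) (T : Finset (Fin s)) :
    awayProj 𝒜 (prod_mem_graded 𝒜 hy T) m (CubeComplex.d (cechMap y) a T) =
      CubeComplex.d (cechMap y) (fun T => awayProj 𝒜 (prod_mem_graded 𝒜 hy T) m (a T)) T :=
  CubeComplex.map_d (k := k) (M := fun T => Localization.Away (∏ j ∈ T, y j))
    (M' := fun T => Localization.Away (∏ j ∈ T, y j)) (cechMap y) (cechMap y)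
    (fun T => awayProj 𝒜 (prod_mem_graded 𝒜 hy T) m)
    (fun i _ z => awayProj_algHom 𝒜 _ _ (cechIncl y (erase_subset i T)) m z) a

/-- Multiplication by `x i` raises the degree by `δ i`, exactly the difference of the twists at `S`
and `S.erase i`. -/
theorem awayProj_diff (hx : ∀ i, x i ∈ 𝒜 (δ i)) {f : R} {e : ℕ} (hf : f ∈ 𝒜 e)
    (a : Finset (Fin n) → Localization.Away f) (S : Finset (Fin n)) :
    awayProj 𝒜 hf (∑ i ∈ S, (δ i : ℤ)) (Koszul.diff x a S) =
      Koszul.diff x (fun S => awayProj 𝒜 hf (∑ i ∈ S, (δ i : ℤ)) (a S)) S := by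
  refine Koszul.map_diff x
    (fun S => awayProj 𝒜 hf (∑ i ∈ S, (δ i : ℤ))) (fun i hi z => ?_) a
  rw [awayProj_smul_of_mem 𝒜 hf (hx i), ← Finset.sum_erase_add _ _ hi, add_sub_cancel_right]

theorem d_cechMap_mem (hy : ∀ j, y j ∈ 𝒜 (ε j)) {m : ℤ}
    {a : ∀ T, Localization.Away (∏ j ∈ T, y j)}
    (ha : ∀ T, a T ∈ awayPiece 𝒜 (∏ j ∈ T, y j) (∑ j ∈ T, ε j) m) (T : Finset (Fin s)) :
    CubeComplex.d (cechMap y) a T ∈ awayPiece 𝒜 (∏ j ∈ T, y j) (∑ j ∈ T, ε j) m := by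
  rw [mem_awayPiece_iff 𝒜 (prod_mem_graded 𝒜 hy T), awayProj_d_cechMap 𝒜 hy]
  refine congrFun (congrArg _ (funext fun T => ?_)) T
  exact (mem_awayPiece_iff 𝒜 (prod_mem_graded 𝒜 hy T)).1 (ha T)

theorem diff_mem (hx : ∀ i, x i ∈ 𝒜 (δ i)) {f : R} {e : ℕ} (hf : f ∈ 𝒜 e)
    {a : Finset (Fin n) → Localization.Away f}
    (ha : ∀ S, a S ∈ awayPiece 𝒜 f e (∑ i ∈ S, (δ i : ℤ))) (S : Finset (Fin n)) :
    Koszul.diff x a S ∈ awayPiece 𝒜 f e (∑ i ∈ S, (δ i : ℤ)) := by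
  rw [mem_awayPiece_iff 𝒜 hf, awayProj_diff 𝒜 hx]
  exact congrFun (congrArg _ (funext fun S => (mem_awayPiece_iff 𝒜 hf).1 (ha S))) S

/-- Write a power `f ^ N` as a homogeneous combination of the `x i` and divide by it. -/
theorem exists_sum_smul_eq_one (hx : ∀ i, x i ∈ 𝒜 (δ i)) {f : R} {e : ℕ} (hf : f ∈ 𝒜 e)
    (hfx : f ∈ (Ideal.span (Set.range x)).radical) :
    ∃ c : Fin n → Localization.Away f, (∀ i, c i ∈ awayPiece 𝒜 f e (-(δ i : ℤ))) ∧
      ∑ i, x i • c i = 1 := by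
  obtain ⟨N, hN⟩ := hfx
  have hfN := SetLike.pow_mem_graded N hf
  obtain ⟨b, hb, hsum⟩ := exists_eq_sum_mul_of_mem_span 𝒜 hx hfN hN
  refine ⟨fun i => Localization.mk (b i) (⟨f ^ N, ⟨N, rfl⟩⟩ : Submonoid.powers f), fun i => ?_, ?_⟩
  · refine Submodule.subset_span ⟨N, b i, ?_, rfl⟩
    rw [neg_add_eq_sub]
    exact_mod_cast hb i
  · simp only [Localization.smul_mk, smul_eq_mul]
    rw [← Localization.mk_sum]
    simp only [mul_comm (x _)]
    rw [← hsum]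
    exact Localization.mk_self (⟨f ^ N, ⟨N, rfl⟩⟩ : Submonoid.powers f)

/-- If `∑ i, x i • c i = 1`, the combination of contractions with coefficients `c j` is a
contracting homotopy. Contraction with `j` raises the degree by `δ j` and `c j` lowers it again, so
internal degrees are respected. -/
theorem exists_diff_eq (hx : ∀ i, x i ∈ 𝒜 (δ i)) {f : R} {e : ℕ} (hf : f ∈ 𝒜 e)
    (hfx : f ∈ (Ideal.span (Set.range x)).radical) {p : ℕ}
    {a : Finset (Fin n) → Localization.Away f} (ha0 : ∀ S, #S ≠ p → a S = 0)
    (ha : ∀ S, a S ∈ awayPiece 𝒜 f e (∑ i ∈ S, (δ i : ℤ))) (hda : Koszul.diff x a = 0) :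
    ∃ b : Finset (Fin n) → Localization.Away f, (∀ S, #S + 1 ≠ p → b S = 0) ∧
      (∀ S, b S ∈ awayPiece 𝒜 f e (∑ i ∈ S, (δ i : ℤ))) ∧ Koszul.diff x b = a := by
  obtain ⟨c, hc, hsum⟩ := exists_sum_smul_eq_one 𝒜 hx hf hfx
  refine ⟨fun S => ∑ j, c j * Koszul.contract j a S, fun S hS => ?_, fun S => ?_, ?_⟩
  · refine Finset.sum_eq_zero fun j _ => ?_
    have h : Koszul.contract j a S ∈ (⊥ : AddSubgroup _) := Koszul.contract_mem fun h =>
      ha0 _ (by rwa [card_insert_of_notMem h])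
    rw [AddSubgroup.mem_bot.1 h, mul_zero]
  · refine sum_mem fun j _ => ?_
    have h : Koszul.contract j a S ∈
        (awayPiece 𝒜 f e (∑ i ∈ S, (δ i : ℤ) + δ j)).toAddSubgroup :=
      Koszul.contract_mem fun h => by
        rw [add_comm, ← Finset.sum_insert (f := fun i => (δ i : ℤ)) h]
        exact ha _
    rw [mem_awayPiece_iff 𝒜 hf, awayProj_mul_of_mem 𝒜 hf (hc j), sub_neg_eq_add,
      (mem_awayPiece_iff 𝒜 hf).1 h]
  · funext S
    have h1 : Koszul.diff x (fun S => ∑ j, c j * Koszul.contract j a S) S =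
        ∑ j, c j * Koszul.diff x (Koszul.contract j a) S := by
      rw [show (fun S => ∑ j, c j * Koszul.contract j a S) =
        ∑ j, fun S => LinearMap.mulLeft R (c j) (Koszul.contract j a S) by
          funext S; simp [Finset.sum_apply], map_sum, Finset.sum_apply]
      exact Finset.sum_congr rfl fun j _ => (Koszul.map_diff x
        (fun _ => LinearMap.mulLeft R (c j))
        (fun i _ z => map_smul (LinearMap.mulLeft R (c j)) (x i) z) _).symm
    have h2 : ∀ j, Koszul.diff x (Koszul.contract j a) S = x j • a S := fun j => by
      rw [← Koszul.diff_contract_add x j a S, hda, Koszul.contract_zero, Pi.zero_apply, add_zero]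
    rw [h1]
    simp only [h2]
    calc ∑ j, c j * x j • a S = (∑ j, x j • c j) * a S := by
          rw [Finset.sum_mul]
          exact Finset.sum_congr rfl fun j _ => by rw [smul_mul_assoc, mul_smul_comm]
      _ = a S := by rw [hsum, one_mul]

/-- By hypothesis `a` differs by a coboundary `d c` from a cocycle `b` of degree `0`. Projecting `a
- b = d c` to degree `m ≠ 0` fixes `a` and kills `b`, so the degree `m` part of `c` bounds `a`. -/
theorem exists_d_cechMap_eq (hy : ∀ j, y j ∈ 𝒜 (ε j)) {q : ℕ} (hH : cechPiece 𝒜 y ε q 0 = ⊤)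
    {m : ℤ} (hm : m ≠ 0) {a : ∀ T, Localization.Away (∏ j ∈ T, y j)}
    (ha0 : ∀ T, #T ≠ q → a T = 0)
    (ha : ∀ T, a T ∈ awayPiece 𝒜 (∏ j ∈ T, y j) (∑ j ∈ T, ε j) m)
    (hda : CubeComplex.d (cechMap y) a = 0) :
    ∃ b : ∀ T, Localization.Away (∏ j ∈ T, y j), (∀ T, #T + 1 ≠ q → b T = 0) ∧
      (∀ T, b T ∈ awayPiece 𝒜 (∏ j ∈ T, y j) (∑ j ∈ T, ε j) m) ∧
      CubeComplex.d (cechMap y) b = a := by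
  obtain ⟨b, c, hb, hc, hdc⟩ := CubeComplex.exists_sub_eq_d_of_cohomologyPiece_eq_top
    (k := k) (M := fun T => Localization.Away (∏ j ∈ T, y j)) (φ := cechMap y)
    (gr := fun S m => awayPiece 𝒜 (∏ j ∈ S, y j) (∑ j ∈ S, ε j) m) hH ha0 hda
  refine ⟨fun T => awayProj 𝒜 (prod_mem_graded 𝒜 hy T) m (c T), fun T hT => ?_,
    fun T => awayProj_mem 𝒜 (prod_mem_graded 𝒜 hy T) m (c T), ?_⟩
  · exact (congrArg _ (hc T hT)).trans (map_zero _)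
  · funext T
    rw [← awayProj_d_cechMap 𝒜 hy, ← hdc, Pi.sub_apply, map_sub, awayProj_of_mem 𝒜 _ (ha T),
      awayProj_of_mem 𝒜 _ (hb T), if_pos rfl, if_neg hm, sub_zero]

/-- Projecting `c` to degree `m` leaves its differential unchanged, since that is already
homogeneous of degree `m`. Thus a homogeneous cocycle that is a coboundary is one within its own
degree. -/
theorem exists_d_cechMap_eq_d (hy : ∀ j, y j ∈ 𝒜 (ε j)) {r : ℕ} {m : ℤ}
    (c : ∀ T, Localization.Away (∏ j ∈ T, y j)) (hc : ∀ T, #T + 1 ≠ r → c T = 0)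
    (hdc : ∀ T, CubeComplex.d (cechMap y) c T ∈
      awayPiece 𝒜 (∏ j ∈ T, y j) (∑ j ∈ T, ε j) m) :
    ∃ c' : ∀ T, Localization.Away (∏ j ∈ T, y j), (∀ T, #T + 1 ≠ r → c' T = 0) ∧
      (∀ T, c' T ∈ awayPiece 𝒜 (∏ j ∈ T, y j) (∑ j ∈ T, ε j) m) ∧
      CubeComplex.d (cechMap y) c' = CubeComplex.d (cechMap y) c := by
  refine ⟨fun T => awayProj 𝒜 (prod_mem_graded 𝒜 hy T) m (c T), fun T hT => ?_,
    fun T => awayProj_mem 𝒜 (prod_mem_graded 𝒜 hy T) m (c T), ?_⟩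
  · exact (congrArg _ (hc T hT)).trans (map_zero _)
  · funext T
    rw [← awayProj_d_cechMap 𝒜 hy, (mem_awayPiece_iff 𝒜 _).1 (hdc T)]

theorem exists_diff_eq_diff (hx : ∀ i, x i ∈ 𝒜 (δ i)) {f : R} {e : ℕ} (hf : f ∈ 𝒜 e)
    (g : R ≃ₗ[R] Localization.Away f) {r : ℕ} (c : Finset (Fin n) → R)
    (hc : ∀ S, #S + 1 ≠ r → c S = 0)
    (hdc : ∀ S, g (Koszul.diff x c S) ∈ awayPiece 𝒜 f e (∑ i ∈ S, (δ i : ℤ))) :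
    ∃ c' : Finset (Fin n) → R, (∀ S, #S + 1 ≠ r → c' S = 0) ∧
      (∀ S, g (c' S) ∈ awayPiece 𝒜 f e (∑ i ∈ S, (δ i : ℤ))) ∧
      Koszul.diff x c' = Koszul.diff x c := by
  have hg : ∀ (b : Finset (Fin n) → R) S, g (Koszul.diff x b S) =
      Koszul.diff x (fun S => g (b S)) S := fun b S =>
    Koszul.map_diff x (fun _ => g.toLinearMap) (fun i _ w => map_smul g (x i) w) b
  refine ⟨fun S => g.symm (awayProj 𝒜 hf (∑ i ∈ S, (δ i : ℤ)) (g (c S))), fun S hS => ?_,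
    fun S => ?_, ?_⟩
  · dsimp only
    rw [hc S hS, map_zero, map_zero, map_zero]
  · rw [g.apply_symm_apply]
    exact awayProj_mem 𝒜 hf _ _
  · funext S
    apply g.injective
    rw [hg]
    simp only [g.apply_symm_apply]
    rw [← awayProj_diff 𝒜 hx, ← hg, (mem_awayPiece_iff 𝒜 hf).1 (hdc S)]

open MixedCochains in
/-- Comparison of the degree `0` pieces of Koszul cohomology and of the cohomology of the Cech
complex, if the latter is concentrated in degree `0` below degree `N`. -/
theorem nonempty_koszulPiece_equiv_cechPiece (hx : ∀ i, x i ∈ 𝒜 (δ i)) (hδ : ∀ i, 0 < δ i)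
    (hy : ∀ j, y j ∈ 𝒜 (ε j)) (hyx : ∀ j, y j ∈ (Ideal.span (Set.range x)).radical) {N r : ℕ}
    (hr : r < N) (hH : ∀ q < N, cechPiece 𝒜 y ε q 0 = ⊤) :
    Nonempty (koszulPiece 𝒜 x δ r 0 ≃ₗ[k] cechPiece 𝒜 y ε r 0) := by
  let P : Finset (Fin n) → ∀ T : Finset (Fin s), Submodule k (Localization.Away (∏ j ∈ T, y j)) :=
    fun S T => awayPiece 𝒜 (∏ j ∈ T, y j) (∑ j ∈ T, ε j) (∑ i ∈ S, (δ i : ℤ))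
  have hPx : ∀ T (a : Finset (Fin n) → Localization.Away (∏ j ∈ T, y j)),
      (∀ S, a S ∈ P S T) → ∀ S, Koszul.diff x a S ∈ P S T := fun T a ha =>
    diff_mem 𝒜 hx (prod_mem_graded 𝒜 hy T) ha
  have hPφ : ∀ S (a : ∀ T, Localization.Away (∏ j ∈ T, y j)), (∀ T, a T ∈ P S T) →
      ∀ T, CubeComplex.d (cechMap y) a T ∈ P S T := fun S a ha => d_cechMap_mem 𝒜 hy ha
  -- For nonempty `S` the Čech degree `∑ i ∈ S, δ i` is positive, hence nonzero.
  have hrow : ∀ p q, q < N →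
      ExactAtTerm (term P (p + 1)) ((dCube n (cechMap y)).restrictScalars k) q := by
    refine fun p q hq => exactAtTerm_dCube fun S hS a ha0 ha hda =>
      exists_d_cechMap_eq 𝒜 hy (hH q hq) (Finset.sum_pos (fun i _ => ?_) ?_).ne' ha0 ha hda
    · exact_mod_cast hδ i
    · exact card_pos.1 (by omega)
  -- For nonempty `T`, the product of the `y j` is divisible by one of them and so lies in the
  -- radical of `(x)`.
  have hcol : ∀ p q, ExactAtTerm (fun p => term P p (q + 1))
      ((dKoszul x fun T => Localization.Away (∏ j ∈ T, y j)).restrictScalars k) p := by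
    refine fun p q => exactAtTerm_dKoszul fun T hT a ha0 ha hda => ?_
    obtain ⟨j, hj⟩ : T.Nonempty := card_pos.1 (by omega)
    exact exists_diff_eq 𝒜 hx (prod_mem_graded 𝒜 hy T)
      (Ideal.mem_of_dvd _ (Finset.dvd_prod_of_mem y hj) (hyx j)) ha0 ha hda
  have h1 : LinearMap.range (toKoszul x P (cechMap y) (awayEmptyEquiv y) r) =
      koszulPiece 𝒜 x δ r 0 := by
    refine range_toKoszul _ (cech_d_d y) hPφ hcol fun S a => ?_
    rw [zero_add]
    exact (awayEmptyEquiv_mem_iff 𝒜 y ε a _).symm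
  have h2 : LinearMap.range (toCube x P (cechMap y) r) = cechPiece 𝒜 y ε r 0 :=
    range_toCube hr hPx hrow fun T => rfl
  rw [← h1, ← h2]
  refine ⟨LinearMap.rangeEquivOfKerEq _ _ (Submodule.ext fun z => ?_)⟩
  rw [LinearMap.mem_ker, LinearMap.mem_ker,
    toCube_eq_zero_iff_isTotalCoboundary hr hPx hrow (exists_d_cechMap_eq_d 𝒜 hy),
    toKoszul_eq_zero_iff_isTotalCoboundary _ (cech_d_d y) hPφ hcol
      (exists_diff_eq_diff 𝒜 hx (prod_mem_graded 𝒜 hy ∅) (awayEmptyEquiv y))]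

end GradedCech

/-! ### Conclusion -/

theorem mainTheorem8 {k R : Type*} [Field k] [CommRing R] [IsNoetherianRing R] [Algebra k R]
    (𝒜 : ℕ → Submodule k R) [GradedAlgebra 𝒜]
    (hk : Function.Bijective (algebraMap k (𝒜 0)))
    (n : ℕ) (hn : ringKrullDim R = n)
    {s : ℕ} (y : Fin s → R) (ε : Fin s → ℕ) (hy : GeneratesIrrelevantUpToRadical 𝒜 y ε)
    (hH : ∀ r < n, cechPiece 𝒜 y ε r 0 = ⊤)
    (x : Fin n → R) (δ : Fin n → ℕ) (hx : IsHomogeneousSystemOfParameters 𝒜 x δ)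
    (r : ℕ) (hr : r < n) :
    Nonempty (koszulPiece 𝒜 x δ r 0 ≃ₗ[k] CechLocalCohomology y r) := by
  -- This is where `R_0 = k` enters: finiteness of the degree `0` piece is needed for the positivity
  -- of the `δ i`.
  have : Module.Finite k (𝒜 0) :=
    Module.Finite.of_surjective (Algebra.linearMap k (𝒜 0)) hk.surjective
  have hyx : ∀ j, y j ∈ (Ideal.span (Set.range x)).radical := fun j => by
    rw [hx.radical_eq, ← hy.radical_eq]
    exact Ideal.le_radical (Ideal.subset_span ⟨j, rfl⟩)
  obtain ⟨E⟩ := nonempty_koszulPiece_equiv_cechPiece 𝒜 hx.homogeneous (hx.degree_pos 𝒜)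
    hy.homogeneous hyx hr hH
  -- Below `n` the degree `0` piece is all of local cohomology.
  exact ⟨E ≪≫ₗ LinearEquiv.ofTop _ (hH r hr)⟩
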